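/- Conventions. An E-field is a field $K$ of characteristic $0$ with a homomorphism $\exp:(K,+)\to(K^*,\cdot)$. The ring $K[x_1,\dots,x_n]^E$ of exponential polynomials over $K$ is the union of the chain $R_0\subseteq R_1\subseteq\cdots$, where $R_0=K[x_1,\dots,x_n]$ with $\exp$ defined exactly on $K$, and $R_{m+1}$ is obtained from $R_m=A_m\oplus B_m$ ($A_m$ the domain of $\exp$ in $R_m$, i.e. $K$ if $m=0$ and $R_{m-1}$ if $m\ge 1$; $B_m$ a $\mathbb{Q}$-linear complement) as the group ring $R_m[B_m]$, with $\exp(a+b)=\exp(a)\exp(b)$ for $a\in A_m$, $b\in B_m$, where $\exp(b)$ is the basis element of the group ring indexed by $b$. An exponential polynomial is evaluated at $\bar a\in K^n$ by the homomorphism to $K$ that fixes $K$, sends $x_i$ to $a_i$ and respects $\exp$. For $\alpha\ge 1$ let $G_\alpha(K)=K^\alpha\times(K^*)^\alpha$; a variety is a Zariski closed subset of it. A variety $V\subseteq G_\alpha(K)$ is free if there are no $m_1,\dots,m_\alpha\in\mathbb{Z}$, not all zero, and $b\in K$ such that $V\subseteq\{(\bar u,\bar v):\prod_i v_i^{m_i}=b\}$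 or $V\subseteq\{(\bar u,\bar v):\sum_i m_iu_i=b\}$. It is rotund if for all $1\le r\le\alpha$ and every $r\times\alpha$ integer matrix $C=(c_{i,j})$ of rank $r$ one has $\dim [C](V)\ge r$, where $[C](\bar u,\bar v)=\big(\sum_j c_{i,j}u_j,\ \prod_j v_j^{c_{i,j}}\big)_{1\le i\le r}\in G_r(K)$. The E-field $K$ is existentially closed if for every $\alpha\ge 1$ and every irreducible, rotund and free variety $V\subseteq G_\alpha(K)$ there are infinitely many $\bar x\in K^\alpha$ with $(\bar x,\exp(\bar x))\in V$. Theorem. Let $\mathcal{K}$ be an algebraically closed E-field of characteristic $0$ that is existentially closed and whose exponential map is surjective onto $\mathcal{K}^*$ with infinite kernel. (These are among the properties of Zilber's pseudoexponential field; Schanuel's conjecture is not assumed.) Let $p\in\mathcal{K}[x_1,\dots,x_n]^E$ be an exponential polynomial. If $p\neq\exp(g)$ for every $g\in\mathcal{K}[x_1,\dots,x_n]^E$, then there is $\bar a\in\mathcal{K}^n$ with $p(\bar a)=0$. -/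

import Mathlib

universe u

noncomputable section

/-! ### Partial exponential rings -/

/-- A partial E-ring: a `ℚ`-algebra without zero divisors, a `ℚ`-linear subspace `dom` of it, and a
homomorphism `exp` from the additive group of `dom` to the group of units.
A (total) E-ring structure on a ring `R` is a term of `AddChar R Rˣ`. -/
structure PartialERing where
  carrier : Type u
  [commRing : CommRing carrier]
  [isDomain : IsDomain carrier]
  [algebra : Algebra ℚ carrier]
  dom : Submodule ℚ carrier
  exp : AddChar dom carrierˣ

namespace PartialERing

attribute [instance] commRing isDomain algebra

variable (R : PartialERing.{u})

/-- A `ℚ`-linear complement of the domain of the exponential map. -/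
def compl : Submodule ℚ R.carrier := Classical.choose R.dom.exists_isCompl

theorem isCompl : IsCompl R.dom R.compl := Classical.choose_spec R.dom.exists_isCompl

/-- The ring `R'` generated over `R` by exponentials of all elements of `R`: the group ring over `R`
of a complement `B` of the domain of `exp`; the basis element indexed by `b ∈ B` is `exp b`. -/
abbrev ExtCarrier : Type u := AddMonoidAlgebra R.carrier R.compl

/-- The inclusion of `R` in `R'`. -/
def incl : R.carrier →ₐ[ℚ] R.ExtCarrier := IsScalarTower.toAlgHom ℚ R.carrier R.ExtCarrier

/-- The exponential map `R → R'`: if `r = a + b` with `a` in the domain of `exp` and `b` in the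
complement, then `exp r = exp a * single b 1`. -/
def expExt : AddChar R.carrier R.ExtCarrierˣ where
  toFun r :=
    Units.map (R.incl : R.carrier →* R.ExtCarrier)
        (R.exp (R.dom.projectionOnto R.compl R.isCompl r)) *
      MonoidHom.toHomUnits (AddMonoidAlgebra.of R.carrier R.compl)
        (Multiplicative.ofAdd (R.compl.projectionOnto R.dom R.isCompl.symm r))
  map_zero_eq_one' := by simp
  map_add_eq_mul' r s := by
    simp only [map_add, AddChar.map_add_eq_mul, ofAdd_add, map_mul]
    exact mul_mul_mul_comm _ _ _ _

theorem incl_coeff_zero (r : R.carrier) : (R.incl r).coeff 0 = r := by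
  simp [incl]

/-- The partial E-ring `R'`; the domain of its exponential map is `R`. -/
def ext : PartialERing.{u} where
  carrier := R.ExtCarrier
  dom := LinearMap.range R.incl.toLinearMap
  exp :=
    { toFun := fun y => R.expExt (y.1.coeff 0)
      map_zero_eq_one' := by simp
      map_add_eq_mul' := fun y z => by simp [AddChar.map_add_eq_mul] }

/-- The inclusion of `R` in `R'`, with values in the carrier of the partial E-ring `R'`. -/
def toExt : R.carrier →+* R.ext.carrier := R.incl.toRingHom

/-- The exponential map `R → R'`, with values in the partial E-ring `R'`. -/
def expToExt : AddChar R.carrier R.ext.carrierˣ := R.expExt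

theorem toExt_mem_dom (r : R.carrier) : R.toExt r ∈ R.ext.dom := ⟨r, rfl⟩

theorem exp_toExt (r : R.carrier) : R.ext.exp ⟨R.toExt r, R.toExt_mem_dom r⟩ = R.expToExt r :=
  congrArg R.expExt (R.incl_coeff_zero r)

/-- `R'` is a partial E-ring extension of `R`. -/
theorem expToExt_dom (a : R.dom) :
    R.expToExt a = Units.map (R.toExt : R.carrier →* R.ext.carrier) (R.exp a) := by
  change R.expExt a = Units.map (R.incl : R.carrier →* R.ExtCarrier) (R.exp a)
  simp [expExt]

theorem expToExt_toExt (r : R.carrier) :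
    R.ext.expToExt (R.toExt r) =
      Units.map (R.ext.toExt : R.ext.carrier →* R.ext.ext.carrier) (R.expToExt r) :=
  (R.ext.expToExt_dom ⟨R.toExt r, R.toExt_mem_dom r⟩).trans (congrArg _ (R.exp_toExt r))

/-- Homomorphisms of partial E-rings from `R` to a ring `K` with total exponential map `e`. -/
structure EHom {K : Type u} [CommRing K] (e : AddChar K Kˣ) where
  toRingHom : R.carrier →+* K
  map_exp : ∀ a : R.dom, toRingHom (R.exp a : R.carrier) = (e (toRingHom a) : K)

variable {R}

/-- The extension to `R'` of a homomorphism from `R` to an E-ring. -/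
def EHom.extRingHom {K : Type u} [CommRing K] {e : AddChar K Kˣ} (φ : R.EHom e) :
    R.ExtCarrier →+* K :=
  AddMonoidAlgebra.liftNCRingHom φ.toRingHom
    ((Units.coeHom K).comp (e.toMonoidHom.comp
      (AddMonoidHom.toMultiplicative
        (φ.toRingHom.toAddMonoidHom.comp R.compl.subtype.toAddMonoidHom))))
    (fun _ _ => Commute.all _ _)

theorem EHom.extRingHom_incl {K : Type u} [CommRing K] {e : AddChar K Kˣ} (φ : R.EHom e)
    (r : R.carrier) : φ.extRingHom (R.incl r) = φ.toRingHom r := by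
  simp [EHom.extRingHom, incl]

theorem EHom.extRingHom_expExt {K : Type u} [CommRing K] {e : AddChar K Kˣ} (φ : R.EHom e)
    (r : R.carrier) : φ.extRingHom (R.expExt r : R.ExtCarrier) = (e (φ.toRingHom r) : K) := by
  have h : r = (R.dom.projectionOnto R.compl R.isCompl r : R.carrier) +
      (R.compl.projectionOnto R.dom R.isCompl.symm r : R.carrier) :=
    (Submodule.projection_add_projection_eq_self R.isCompl r).symm
  conv_rhs => rw [h, map_add, AddChar.map_add_eq_mul, Units.val_mul, ← φ.map_exp]
  change φ.extRingHom (R.incl _ * AddMonoidAlgebra.single _ 1) = _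
  rw [map_mul, φ.extRingHom_incl]
  simp [EHom.extRingHom]

/-- The extension of a homomorphism to `R'` respects exponentials. -/
def EHom.ext {K : Type u} [CommRing K] {e : AddChar K Kˣ} (φ : R.EHom e) : R.ext.EHom e where
  toRingHom := φ.extRingHom
  map_exp := by
    rintro ⟨_, r, rfl⟩
    change φ.extRingHom (R.expExt ((R.incl r).coeff 0) : R.ExtCarrier) =
      (e (φ.extRingHom (R.incl r)) : K)
    rw [incl_coeff_zero, EHom.extRingHom_expExt, EHom.extRingHom_incl]

end PartialERing

/-! ### The ring of exponential polynomials -/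

section ExpPoly

variable {K : Type u} [Field K] [CharZero K] (e : AddChar K Kˣ) (n : ℕ)

/-- The polynomial ring `K[x₁, …, xₙ]` as a partial E-ring whose exponential map is defined exactly
on `K`, where it is the exponential map `e` of `K`. -/
def polyPartialERing : PartialERing.{u} where
  carrier := MvPolynomial (Fin n) K
  dom := LinearMap.range (IsScalarTower.toAlgHom ℚ K (MvPolynomial (Fin n) K)).toLinearMap
  exp :=
    { toFun := fun y => Units.map ((MvPolynomial.C : K →+* MvPolynomial (Fin n) K) : K →* MvPolynomial (Fin n) K)
        (e (MvPolynomial.constantCoeff y.1))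
      map_zero_eq_one' := by simp
      map_add_eq_mul' := fun y z => by simp [AddChar.map_add_eq_mul] }

/-- The chain `R₀ = K[x₁, …, xₙ]`, `Rₘ₊₁ = Rₘ'`. -/
def expChain : ℕ → PartialERing.{u}
  | 0 => polyPartialERing e n
  | m + 1 => (expChain m).ext

/-- The inclusion `Rₘ → Rₘ₊₁`. -/
def expChainStep (m : ℕ) : (expChain e n m).carrier →+* (expChain e n (m + 1)).carrier :=
  (expChain e n m).toExt

/-- The exponential map `Rₘ → Rₘ₊₁`. -/
def expChainExp (m : ℕ) : AddChar (expChain e n m).carrier (expChain e n (m + 1)).carrierˣ :=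
  (expChain e n m).expToExt

theorem expChainExp_step (m : ℕ) (x : (expChain e n m).carrier) :
    expChainExp e n (m + 1) (expChainStep e n m x) =
      Units.map (expChainStep e n (m + 1) :
        (expChain e n (m + 1)).carrier →* (expChain e n (m + 2)).carrier) (expChainExp e n m x) :=
  (expChain e n m).expToExt_toExt x

/-- The inclusion `Rᵢ → Rⱼ` for `i ≤ j`. -/
def expChainMap (i j : ℕ) (h : i ≤ j) : (expChain e n i).carrier →+* (expChain e n j).carrier :=
  Nat.leRec (motive := fun j _ => (expChain e n i).carrier →+* (expChain e n j).carrier)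
    (RingHom.id _) (fun k _ f => (expChainStep e n k).comp f) h

theorem expChainMap_self (i : ℕ) (x : (expChain e n i).carrier) :
    expChainMap e n i i le_rfl x = x := by
  simp [expChainMap]

theorem expChainMap_succ (i j : ℕ) (h : i ≤ j) (x : (expChain e n i).carrier) :
    expChainMap e n i (j + 1) (Nat.le_succ_of_le h) x =
      expChainStep e n j (expChainMap e n i j h x) := by
  rw [expChainMap, Nat.leRec_succ _ _ h]; rfl

instance expChain_directedSystem :
    DirectedSystem (fun i => (expChain e n i).carrier) (expChainMap e n · · ·) where
  map_self i x := expChainMap_self e n i x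
  map_map k j i hij hjk x := by
    induction hjk with
    | refl => exact expChainMap_self e n _ _
    | step h ih => rw [expChainMap_succ e n _ _ h, ih, ← expChainMap_succ e n _ _ (hij.trans h)]

/-- The exponential polynomial ring `K[x₁, …, xₙ]^E` over the E-field `(K, e)`: the union of the
chain `R₀ ⊆ R₁ ⊆ R₂ ⊆ ⋯`. -/
abbrev ExpPoly : Type u :=
  DirectLimit (fun i => (expChain e n i).carrier) (expChainMap e n)

namespace ExpPoly

/-- The inclusion of `Rᵢ` in the union of the chain. -/
def of (i : ℕ) : (expChain e n i).carrier →+* ExpPoly e n where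
  toFun x := ⟦⟨i, x⟩⟧
  map_one' := (DirectLimit.one_def i).symm
  map_mul' x y := (DirectLimit.mul_def (f := expChainMap e n) i x y).symm
  map_zero' := (DirectLimit.zero_def i).symm
  map_add' x y := (DirectLimit.add_def (f := expChainMap e n) i x y).symm

theorem of_expChainMap (i j : ℕ) (h : i ≤ j) (x : (expChain e n i).carrier) :
    of e n j (expChainMap e n i j h x) = of e n i x :=
  DirectLimit.mk_apply (F := fun i => (expChain e n i).carrier) (f := expChainMap e n) i j x h

theorem of_step (i : ℕ) (x : (expChain e n i).carrier) :
    of e n (i + 1) (expChainStep e n i x) = of e n i x := by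
  rw [← of_expChainMap e n i (i + 1) (Nat.le_succ i), expChainMap_succ e n i i le_rfl,
    expChainMap_self]

/-- The exponential of an element of `Rᵢ`; it lies in `Rᵢ₊₁`. -/
def expOf (i : ℕ) (x : (expChain e n i).carrier) : (ExpPoly e n)ˣ :=
  Units.map (of e n (i + 1) : (expChain e n (i + 1)).carrier →* ExpPoly e n)
    (expChainExp e n i x)

theorem expOf_step (i : ℕ) (x : (expChain e n i).carrier) :
    expOf e n (i + 1) (expChainStep e n i x) = expOf e n i x := by
  ext
  rw [expOf, expChainExp_step]
  exact of_step e n (i + 1) _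

theorem expOf_expChainMap (i j : ℕ) (h : i ≤ j) (x : (expChain e n i).carrier) :
    expOf e n i x = expOf e n j (expChainMap e n i j h x) := by
  induction h with
  | refl => rw [expChainMap_self]
  | step h ih => rw [expChainMap_succ e n _ _ h, expOf_step, ih]

variable {e n}

/-- The exponential map of `K[x₁, …, xₙ]^E`. -/
def exp : AddChar (ExpPoly e n) (ExpPoly e n)ˣ where
  toFun := DirectLimit.lift _ (expOf e n) (expOf_expChainMap e n)
  map_zero_eq_one' := by
    rw [DirectLimit.zero_def (0 : ℕ), DirectLimit.lift_def]
    simp [expOf]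
  map_add_eq_mul' := DirectLimit.induction₂ _ fun i x y => by
    rw [DirectLimit.add_def, DirectLimit.lift_def, DirectLimit.lift_def, DirectLimit.lift_def]
    simp [expOf, AddChar.map_add_eq_mul]

/-- The constant exponential polynomial `c`. -/
def C (c : K) : ExpPoly e n := of e n 0 (MvPolynomial.C c : MvPolynomial (Fin n) K)

/-- The variable `xᵢ` as an exponential polynomial. -/
def X (i : Fin n) : ExpPoly e n := of e n 0 (MvPolynomial.X i : MvPolynomial (Fin n) K)

/-- Evaluation at `a ∈ Kⁿ` on the stages of the chain. -/
def evalChain (a : Fin n → K) : (i : ℕ) → (expChain e n i).EHom e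
  | 0 =>
    { toRingHom := MvPolynomial.eval a
      map_exp := by
        rintro ⟨_, c, rfl⟩
        change MvPolynomial.eval a (MvPolynomial.C
          (e (MvPolynomial.constantCoeff (MvPolynomial.C c : MvPolynomial (Fin n) K)) : K)) =
          (e (MvPolynomial.eval a (MvPolynomial.C c)) : K)
        simp }
  | i + 1 => (evalChain a i).ext

theorem evalChain_step (a : Fin n → K) (i : ℕ) (x : (expChain e n i).carrier) :
    (evalChain a (i + 1)).toRingHom (expChainStep e n i x) = (evalChain a i).toRingHom x :=
  (evalChain a i).extRingHom_incl x

theorem evalChain_expChainMap (a : Fin n → K) (i j : ℕ) (h : i ≤ j)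
    (x : (expChain e n i).carrier) :
    (evalChain a i).toRingHom x = (evalChain a j).toRingHom (expChainMap e n i j h x) := by
  induction h with
  | refl => rw [expChainMap_self]
  | step h ih => rw [expChainMap_succ e n _ _ h, evalChain_step, ih]

/-- The value `p(a) ∈ K` of an exponential polynomial `p` at `a ∈ Kⁿ`: the homomorphism that fixes
constants, sends `xᵢ` to `aᵢ` and respects exponentials. -/
def eval (a : Fin n → K) : ExpPoly e n →+* K where
  toFun := DirectLimit.lift _ (fun i x => (evalChain a i).toRingHom x) (evalChain_expChainMap a)
  map_one' := by rw [DirectLimit.one_def (0 : ℕ), DirectLimit.lift_def]; exact map_one _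
  map_zero' := by rw [DirectLimit.zero_def (0 : ℕ), DirectLimit.lift_def]; exact map_zero _
  map_mul' := DirectLimit.induction₂ _ fun i x y => by
    rw [DirectLimit.mul_def, DirectLimit.lift_def, DirectLimit.lift_def, DirectLimit.lift_def]
    exact map_mul _ _ _
  map_add' := DirectLimit.induction₂ _ fun i x y => by
    rw [DirectLimit.add_def, DirectLimit.lift_def, DirectLimit.lift_def, DirectLimit.lift_def]
    exact map_add _ _ _

theorem eval_of (a : Fin n → K) (i : ℕ) (x : (expChain e n i).carrier) :
    eval a (of e n i x) = (evalChain a i).toRingHom x := rfl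

theorem exp_of (i : ℕ) (x : (expChain e n i).carrier) :
    (exp (of e n i x) : ExpPoly e n) = of e n (i + 1) (expChainExp e n i x) := rfl

/-- On constants, the exponential map of `K[x₁, …, xₙ]^E` is that of `K`. -/
theorem exp_C (c : K) : (exp (C c : ExpPoly e n) : ExpPoly e n) = C (e c : K) := by
  have h : expChainExp e n 0 (MvPolynomial.C c : MvPolynomial (Fin n) K) =
      Units.map (expChainStep e n 0 : (expChain e n 0).carrier →* (expChain e n 1).carrier)
        ((polyPartialERing e n).exp ⟨(MvPolynomial.C c : MvPolynomial (Fin n) K), c, rfl⟩) :=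
    (polyPartialERing e n).expToExt_dom ⟨(MvPolynomial.C c : MvPolynomial (Fin n) K), c, rfl⟩
  refine (exp_of 0 _).trans ((congrArg (fun y => of e n 1 (Units.val y)) h).trans ?_)
  refine (of_step e n 0 _).trans (congrArg (of e n 0) ?_)
  change MvPolynomial.C (e (MvPolynomial.constantCoeff (MvPolynomial.C c)) : K) = _
  rw [MvPolynomial.constantCoeff_C]

theorem eval_C (a : Fin n → K) (c : K) : eval a (C c : ExpPoly e n) = c :=
  (eval_of a 0 _).trans (MvPolynomial.eval_C (σ := Fin n) (f := a) c)

theorem eval_X (a : Fin n → K) (i : Fin n) : eval a (X i : ExpPoly e n) = a i :=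
  (eval_of a 0 _).trans (MvPolynomial.eval_X (f := a) i)

theorem eval_exp (a : Fin n → K) (p : ExpPoly e n) :
    eval a (exp p : ExpPoly e n) = (e (eval a p) : K) := by
  obtain ⟨i, x, rfl⟩ : ∃ i x, p = of e n i x := DirectLimit.exists_eq_mk _ p
  rw [exp_of, eval_of, eval_of]
  exact (evalChain a i).extRingHom_expExt x

end ExpPoly

end ExpPoly

/-! ### Varieties in `K^α × (K^*)^α` and existential closedness -/

section Varieties

variable {K : Type u} [Field K]

/-- The points of `G_α(K) = K^α × (K^*)^α`. -/
abbrev GPoint (K : Type u) [Field K] (α : ℕ) : Type u := (Fin α → K) × (Fin α → Kˣ)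

/-- The `2α` coordinates of a point of `G_α(K)`. -/
def GPoint.coords {α : ℕ} (P : GPoint K α) : Fin α ⊕ Fin α → K :=
  Sum.elim P.1 (fun i => (P.2 i : K))

/-- A variety: a Zariski closed subset of `G_α(K)`, possibly reducible. -/
def IsGVariety {α : ℕ} (V : Set (GPoint K α)) : Prop :=
  ∃ S : Set (MvPolynomial (Fin α ⊕ Fin α) K), V = {P | ∀ f ∈ S, MvPolynomial.eval P.coords f = 0}

/-- An irreducible variety: nonempty, and not the union of two proper subvarieties. -/
def IsIrreducibleGVariety {α : ℕ} (V : Set (GPoint K α)) : Prop :=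
  IsGVariety V ∧ V.Nonempty ∧
    ∀ V₁ V₂ : Set (GPoint K α), IsGVariety V₁ → IsGVariety V₂ → V = V₁ ∪ V₂ → V = V₁ ∨ V = V₂

/-- A variety is free if it is contained neither in a variety `∏ vᵢ ^ mᵢ = b` nor in a variety
`∑ mᵢ uᵢ = b`, with `b ∈ K` and integers `mᵢ` that are not all zero. -/
def IsFreeGVariety {α : ℕ} (V : Set (GPoint K α)) : Prop :=
  ∀ m : Fin α → ℤ, m ≠ 0 → ∀ b : K,
    ¬ V ⊆ {P | ∏ i, (P.2 i : K) ^ m i = b} ∧ ¬ V ⊆ {P | ∑ i, (m i : K) * P.1 i = b}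

/-- The map `[C] : G_α(K) → G_r(K)` given by an `r × α` matrix `C` of integers. -/
def matrixAction {r α : ℕ} (C : Matrix (Fin r) (Fin α) ℤ) (P : GPoint K α) : GPoint K r :=
  (fun i => ∑ j, (C i j : K) * P.1 j, fun i => ∏ j, P.2 j ^ C i j)

/-- The dimension of (the Zariski closure of) a subset of `G_r(K)`: the transcendence degree
over `K` of its ring of polynomial functions. -/
def gDim {r : ℕ} (S : Set (GPoint K r)) : Cardinal.{u} :=
  Algebra.trdeg K (MvPolynomial (Fin r ⊕ Fin r) K ⧸
    MvPolynomial.vanishingIdeal K (GPoint.coords '' S))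

/-- A variety `V ⊆ G_α(K)` is rotund if `dim [C](V) ≥ r` for every `r × α` matrix `C` of integers
of rank `r`, `1 ≤ r ≤ α`. -/
def IsRotund {α : ℕ} (V : Set (GPoint K α)) : Prop :=
  ∀ r : ℕ, 1 ≤ r → r ≤ α → ∀ C : Matrix (Fin r) (Fin α) ℤ, (C.map (Int.cast : ℤ → ℚ)).rank = r →
    (r : Cardinal.{u}) ≤ gDim (matrixAction C '' V)

/-- The existential closedness axiom for an E-field `(K, e)`: every irreducible, rotund and free
variety `V ⊆ G_α(K)`, `α ≥ 1`, contains `(x, exp x)` for infinitely many `x`. -/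
def ExistentialClosedness (e : AddChar K Kˣ) : Prop :=
  ∀ α : ℕ, 1 ≤ α → ∀ V : Set (GPoint K α),
    IsIrreducibleGVariety V → IsRotund V → IsFreeGVariety V →
      {x : Fin α → K | ((x, fun i => e (x i)) : GPoint K α) ∈ V}.Infinite

end Varieties

end

/-!
Write an exponential polynomial `p` as a polynomial in the variables `xⱼ` and finitely many
exponentials `exp tᵢ` and their inverses, where the `tᵢ` are `ℤ`-linearly independent modulo
constants and each `tᵢ` is itself a polynomial in the `xⱼ` and the `exp tⱼ ^ ±1` with `j < i`
(`IsExpSequence.exists_mem`; an exponential whose exponent is a rational combination of the earlier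
ones is accommodated by dividing the whole sequence by an integer). So `p` comes from an element of
a ring of polynomials in `xⱼ` and Laurent polynomials in `vᵢ`, the class `τᵢ` of `tᵢ` lies in the
subring `lower i` of the variables below `vᵢ`, and every point `a` of `Kⁿ` gives an evaluation of
this ring that sends `vᵢ` to `exp` of the value of `τᵢ` (`IsExpTower`). If, up to monomials in the
`vᵢ`, `p` is a constant, then it is zero or an exponential. Otherwise it has a prime factor `P`
that is not one of the `vᵢ`, and it suffices to find a zero of `P`.

This is done by induction on the largest `k` such that `v_k` occurs in `P`. If no `v_k` occurs, the
Nullstellensatz applies. In general let `F` be the function field of the hypersurface `P = 0`, and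
consider the generic point `(τᵢ, vᵢ)`, with `i` ranging over the indices up to `k`, or up to `n` if
that is larger. If its locus over `K` is free and rotund, existential closedness gives a point
`(a, exp a)` of the locus, and since the relations expressing `τᵢ` through the lower variables hold
there, this point comes from a zero of `P` (`exists_ev_eq_zero_of_specialization`).

* Additive freeness: an additive relation `∑ mᵢ τᵢ = b` on `P = 0` means that `P` divides a nonzero
  element of `lower k`. Then `v_k` does not occur in `P`.
* Multiplicative freeness: if `v ^ m` is constant on `P = 0`, then `P = 0` contains the whole locus
  `v ^ m' = b'` for some primitive `m'` (`exists_vMonomial_of_map_eq`), so that it is enough to solve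
  `∑ m'ᵢ τᵢ = β + κ`, where `exp β = b'`, for some `κ` in the kernel of `exp`. Of two such equations,
  at least one is not given by a monomial, and it has a solution by the induction hypothesis
  (`PrimesHaveZeros.exists_exp_eq`).
* Rotundity (`le_eRk_range_matrix`): let `C` be an integer matrix of rank `r`. In the matroid of
  algebraic independence, `(x, v)` has corank at most one. A combination `s` of the rows of `C`
  whose last nonzero coordinate is as early as possible is a nonconstant function of `x` and of `v`'s
  that can be taken among the coordinates complementary to the rows of `C`; submodularity, applied to these
  coordinates and to the image of the generic point under `C`, which have `s` in the intersection of
  their closures, bounds the rank of the image from below by `r`.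
-/

noncomputable section

/-! ### Points of finitely generated algebras -/

/-- The weak Nullstellensatz: a nonzero finitely generated algebra over an algebraically closed
field `K` has a `K`-point. -/
theorem nonempty_algHom_of_finiteType (K D : Type*) [Field K] [IsAlgClosed K] [CommRing D]
    [Nontrivial D] [Algebra K D] [Algebra.FiniteType K D] : Nonempty (D →ₐ[K] K) := by
  obtain ⟨m, hm⟩ := Ideal.exists_maximal D
  let := Ideal.Quotient.field m
  have := finite_of_finite_type_of_isJacobsonRing K (D ⧸ m)
  exact ⟨(IsAlgClosed.lift : (D ⧸ m) →ₐ[K] K).comp (Ideal.Quotient.mkₐ K m)⟩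

/-- The geometric form of the Nullstellensatz: over an algebraically closed field, a nonzero
element of a finitely generated domain does not vanish at some `K`-point. -/
theorem exists_algHom_adjoin_ne_zero {K F : Type*} [Field K] [IsAlgClosed K] [Field F] [Algebra K F]
    {S : Set F} (hS : S.Finite) {g : F} (hg : g ∈ Algebra.adjoin K S) (hg0 : g ≠ 0) :
    ∃ φ : Algebra.adjoin K S →ₐ[K] K, φ ⟨g, hg⟩ ≠ 0 := by
  have hle : Algebra.adjoin K S ≤ Algebra.adjoin K (insert g⁻¹ S) :=
    Algebra.adjoin_mono (Set.subset_insert _ _)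
  have hgi : g⁻¹ ∈ Algebra.adjoin K (insert g⁻¹ S) :=
    Algebra.subset_adjoin (Set.mem_insert _ _)
  have hfg : Algebra.FiniteType K (Algebra.adjoin K (insert g⁻¹ S)) :=
    Subalgebra.fg_iff_finiteType _ |>.mp (Subalgebra.fg_def.mpr ⟨_, hS.insert _, rfl⟩)
  obtain ⟨ψ⟩ := nonempty_algHom_of_finiteType K (Algebra.adjoin K (insert g⁻¹ S))
  refine ⟨ψ.comp (Subalgebra.inclusion hle), fun h0 => ?_⟩
  have h1 : (⟨g, hle hg⟩ : Algebra.adjoin K (insert g⁻¹ S)) * ⟨g⁻¹, hgi⟩ = 1 :=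
    Subtype.ext (mul_inv_cancel₀ hg0)
  have h2 := congrArg ψ h1
  rw [map_mul, map_one] at h2
  have h3 : ψ ⟨g, hle hg⟩ = 0 := h0
  rw [h3, zero_mul] at h2
  exact zero_ne_one h2

/-! ### Loci of generic points and existential closedness -/

section Locus

variable {K F : Type u} [Field K] [Field F] [Algebra K F] {k : ℕ}

/-- The locus over `K` of the point `(u, v)` of `G_k(F)`: the points of `G_k(K)` at which all
polynomial relations of `(u, v)` over `K` hold. -/
def locus (K : Type u) {F : Type u} [Field K] [Field F] [Algebra K F] {k : ℕ}
    (u v : Fin k → F) : Set (GPoint K k) :=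
  {P | ∀ f : MvPolynomial (Fin k ⊕ Fin k) K, MvPolynomial.aeval (Sum.elim u v) f = 0 →
    MvPolynomial.eval P.coords f = 0}

theorem isGVariety_locus (u v : Fin k → F) : IsGVariety (locus K u v) :=
  ⟨{f | MvPolynomial.aeval (Sum.elim u v) f = 0}, rfl⟩

/-- The coordinates of a generic point and the inverses of its multiplicative coordinates. -/
def coordSet (u v : Fin k → F) : Set F :=
  (Set.range u ∪ Set.range v) ∪ Set.range (fun i => (v i)⁻¹)

theorem finite_coordSet (u v : Fin k → F) : (coordSet u v).Finite :=
  ((Set.finite_range u).union (Set.finite_range v)).union (Set.finite_range _)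

theorem left_mem_adjoin (u v : Fin k → F) (i : Fin k) :
    u i ∈ Algebra.adjoin K (coordSet u v) :=
  Algebra.subset_adjoin (Or.inl (Or.inl ⟨i, rfl⟩))

theorem right_mem_adjoin (u v : Fin k → F) (i : Fin k) :
    v i ∈ Algebra.adjoin K (coordSet u v) :=
  Algebra.subset_adjoin (Or.inl (Or.inr ⟨i, rfl⟩))

theorem inv_mem_adjoin (u v : Fin k → F) (i : Fin k) :
    (v i)⁻¹ ∈ Algebra.adjoin K (coordSet u v) :=
  Algebra.subset_adjoin (Or.inr ⟨i, rfl⟩)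

/-- The multiplicative coordinates as units of the coordinate ring of the locus. -/
def unitCoord (u : Fin k → F) {v : Fin k → F} (hv : ∀ i, v i ≠ 0) (i : Fin k) :
    (Algebra.adjoin K (coordSet u v))ˣ where
  val := ⟨v i, right_mem_adjoin u v i⟩
  inv := ⟨(v i)⁻¹, inv_mem_adjoin u v i⟩
  val_inv := Subtype.ext (mul_inv_cancel₀ (hv i))
  inv_val := Subtype.ext (inv_mul_cancel₀ (hv i))

theorem coe_unitCoord_zpow (u : Fin k → F) {v : Fin k → F} (hv : ∀ i, v i ≠ 0) (i : Fin k)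
    (m : ℤ) : (((unitCoord (K := K) u hv i ^ m :
      (Algebra.adjoin K (coordSet u v))ˣ) : Algebra.adjoin K (coordSet u v)) : F) = v i ^ m := by
  have h := congrArg Units.val
    (map_zpow (Units.map ((Algebra.adjoin K (coordSet u v)).val :
      Algebra.adjoin K (coordSet u v) →* F)) (unitCoord (K := K) u hv i) m)
  rw [Units.val_zpow_eq_zpow_val] at h
  exact h

/-- The point of `G_k(K)` given by a homomorphism from the coordinate ring of the locus. -/
def pointOfHom (u : Fin k → F) {v : Fin k → F} (hv : ∀ i, v i ≠ 0)
    (φ : Algebra.adjoin K (coordSet u v) →ₐ[K] K) : GPoint K k :=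
  (fun i => φ ⟨u i, left_mem_adjoin u v i⟩,
    fun i => Units.map (φ : Algebra.adjoin K (coordSet u v) →* K) (unitCoord u hv i))

/-- The generic point `(u, v)` over the coordinate ring of the locus. -/
def genericCoords (u v : Fin k → F) : Fin k ⊕ Fin k → Algebra.adjoin K (coordSet u v) :=
  Sum.elim (fun i => ⟨u i, left_mem_adjoin u v i⟩) (fun i => ⟨v i, right_mem_adjoin u v i⟩)

theorem coe_aeval_genericCoords (u v : Fin k → F) (f : MvPolynomial (Fin k ⊕ Fin k) K) :
    ((MvPolynomial.aeval (genericCoords u v) f : Algebra.adjoin K (coordSet u v)) : F) =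
      MvPolynomial.aeval (Sum.elim u v) f := by
  refine (MvPolynomial.comp_aeval_apply _ (Algebra.adjoin K (coordSet u v)).val f).trans ?_
  congr 2
  funext i
  cases i <;> rfl

theorem aeval_mem_adjoin (u v : Fin k → F) (f : MvPolynomial (Fin k ⊕ Fin k) K) :
    MvPolynomial.aeval (Sum.elim u v) f ∈ Algebra.adjoin K (coordSet u v) :=
  coe_aeval_genericCoords u v f ▸ (MvPolynomial.aeval (genericCoords u v) f).2

theorem eval_pointOfHom (u : Fin k → F) {v : Fin k → F} (hv : ∀ i, v i ≠ 0)
    (φ : Algebra.adjoin K (coordSet u v) →ₐ[K] K) (f : MvPolynomial (Fin k ⊕ Fin k) K) :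
    MvPolynomial.eval (pointOfHom u hv φ).coords f =
      φ ⟨MvPolynomial.aeval (Sum.elim u v) f, aeval_mem_adjoin u v f⟩ := by
  have h1 : (pointOfHom u hv φ).coords = φ ∘ genericCoords u v := by
    funext i
    cases i <;> rfl
  have h2 : MvPolynomial.aeval (genericCoords u v) f =
      ⟨MvPolynomial.aeval (Sum.elim u v) f, aeval_mem_adjoin u v f⟩ :=
    Subtype.ext (coe_aeval_genericCoords u v f)
  rw [h1, ← h2, MvPolynomial.comp_aeval_apply, MvPolynomial.aeval_eq_eval]
  rfl

theorem pointOfHom_mem_locus (u : Fin k → F) {v : Fin k → F} (hv : ∀ i, v i ≠ 0)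
    (φ : Algebra.adjoin K (coordSet u v) →ₐ[K] K) : pointOfHom u hv φ ∈ locus K u v := by
  intro f hf
  rw [eval_pointOfHom]
  simp_rw [hf]
  exact map_zero φ

/-- The coordinate functions of the image of the locus under a matrix are the expected monomial
expressions of the generic point. -/
theorem eval_matrixAction_pointOfHom (u : Fin k → F) {v : Fin k → F} (hv : ∀ i, v i ≠ 0)
    {r : ℕ} (C : Matrix (Fin r) (Fin k) ℤ) (f : MvPolynomial (Fin r ⊕ Fin r) K) :
    ∃ h : MvPolynomial.aeval (Sum.elim (fun i => ∑ j, (C i j : F) * u j)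
        (fun i => ∏ j, v j ^ C i j)) f ∈ Algebra.adjoin K (coordSet u v),
      ∀ φ : Algebra.adjoin K (coordSet u v) →ₐ[K] K,
        MvPolynomial.eval (matrixAction C (pointOfHom u hv φ)).coords f = φ ⟨_, h⟩ := by
  let g : Fin r ⊕ Fin r → Algebra.adjoin K (coordSet u v) :=
    Sum.elim
      (fun i => ∑ j, (C i j : Algebra.adjoin K (coordSet u v)) * ⟨u j, left_mem_adjoin u v j⟩)
      (fun i => ((∏ j, unitCoord u hv j ^ C i j : (Algebra.adjoin K (coordSet u v))ˣ) :
        Algebra.adjoin K (coordSet u v)))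
  have hg : ∀ f : MvPolynomial (Fin r ⊕ Fin r) K, ((MvPolynomial.aeval (R := K) g f : Algebra.adjoin K (coordSet u v)) : F) =
      MvPolynomial.aeval (Sum.elim (fun i => ∑ j, (C i j : F) * u j)
        (fun i => ∏ j, v j ^ C i j)) f := by
    intro f
    have h1 : (Algebra.adjoin K (coordSet u v)).val.comp (MvPolynomial.aeval (R := K) g) =
      MvPolynomial.aeval (Sum.elim (fun i => ∑ j, (C i j : F) * u j)
        (fun i => ∏ j, v j ^ C i j)) := by
      apply MvPolynomial.algHom_ext
      rintro (i | i)
      · simp [g]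
      · simp only [g, AlgHom.comp_apply, MvPolynomial.aeval_X, Sum.elim_inr, Units.coe_prod,
          map_prod, Subalgebra.coe_val]
        exact Finset.prod_congr rfl fun j _ => coe_unitCoord_zpow u hv j _
    exact DFunLike.congr_fun h1 f
  refine ⟨hg f ▸ (MvPolynomial.aeval g f).2, fun φ => ?_⟩
  have h2 : (matrixAction C (pointOfHom u hv φ)).coords = φ ∘ g := by
    funext i
    cases i with
    | inl i => simp [g, matrixAction, pointOfHom, GPoint.coords]
    | inr i =>
      refine Eq.trans ?_ (Units.coe_map (φ : Algebra.adjoin K (coordSet u v) →* K) _)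
      rw [map_prod]
      simp_rw [map_zpow]
      rfl
  have h3 : MvPolynomial.aeval g f = ⟨_, hg f ▸ (MvPolynomial.aeval g f).2⟩ := Subtype.ext (hg f)
  rw [h2, ← h3, MvPolynomial.comp_aeval_apply, MvPolynomial.aeval_eq_eval]
  rfl

variable [IsAlgClosed K]

theorem aeval_eq_zero_of_forall_eval_eq_zero (u : Fin k → F) {v : Fin k → F} (hv : ∀ i, v i ≠ 0)
    {f : MvPolynomial (Fin k ⊕ Fin k) K}
    (hf : ∀ P ∈ locus K u v, MvPolynomial.eval P.coords f = 0) :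
    MvPolynomial.aeval (Sum.elim u v) f = 0 := by
  by_contra h0
  obtain ⟨φ, hφ⟩ := exists_algHom_adjoin_ne_zero (finite_coordSet u v) (aeval_mem_adjoin u v f) h0
  exact hφ (by rw [← eval_pointOfHom u hv]; exact hf _ (pointOfHom_mem_locus u hv φ))

theorem isIrreducibleGVariety_locus (u : Fin k → F) {v : Fin k → F} (hv : ∀ i, v i ≠ 0) :
    IsIrreducibleGVariety (locus K u v) := by
  refine ⟨isGVariety_locus u v, ?_, ?_⟩
  · by_contra hne
    have h := aeval_eq_zero_of_forall_eval_eq_zero (K := K) u hv (f := 1)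
      (fun P hP => (hne ⟨P, hP⟩).elim)
    rw [map_one] at h
    exact one_ne_zero h
  · rintro V₁ V₂ ⟨S₁, rfl⟩ ⟨S₂, rfl⟩ hU
    by_contra! hcon
    have key : ∀ S : Set (MvPolynomial (Fin k ⊕ Fin k) K),
        {P : GPoint K k | ∀ f ∈ S, MvPolynomial.eval P.coords f = 0} ⊆ locus K u v →
        locus K u v ≠ {P | ∀ f ∈ S, MvPolynomial.eval P.coords f = 0} →
        ∃ f ∈ S, MvPolynomial.aeval (Sum.elim u v) f ≠ 0 := by
      intro S hS hne
      by_contra! h0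
      exact hne (Set.Subset.antisymm (fun P hP f hf => hP f (h0 f hf)) hS)
    obtain ⟨f, hf, hf0⟩ := key S₁ (hU ▸ Set.subset_union_left) hcon.1
    obtain ⟨g, hg, hg0⟩ := key S₂ (hU ▸ Set.subset_union_right) hcon.2
    have h := aeval_eq_zero_of_forall_eval_eq_zero (K := K) u hv (f := f * g) (by
      intro P hP
      rw [hU] at hP
      rw [map_mul]
      rcases hP with hP | hP
      · rw [hP f hf, zero_mul]
      · rw [hP g hg, mul_zero])
    rw [map_mul] at h
    exact mul_ne_zero hf0 hg0 h

theorem eRk_le_gDim_matrixAction (u : Fin k → F) {v : Fin k → F} (hv : ∀ i, v i ≠ 0)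
    {r : ℕ} (C : Matrix (Fin r) (Fin k) ℤ)
    (hr : (r : ℕ∞) ≤ (AlgebraicIndependent.matroid K F).eRk
      (Set.range (Sum.elim (fun i => ∑ j, (C i j : F) * u j) (fun i => ∏ j, v j ^ C i j)))) :
    (r : Cardinal.{u}) ≤ gDim (matrixAction C '' locus K u v) := by
  set w : Fin r ⊕ Fin r → F :=
    Sum.elim (fun i => ∑ j, (C i j : F) * u j) (fun i => ∏ j, v j ^ C i j) with hw
  have hvan : ∀ f ∈ MvPolynomial.vanishingIdeal K (GPoint.coords '' (matrixAction C '' locus K u v)),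
      MvPolynomial.aeval w f = 0 := by
    intro f hf
    by_contra h0
    obtain ⟨h, hφ⟩ := eval_matrixAction_pointOfHom u hv C f
    obtain ⟨φ, hφ0⟩ := exists_algHom_adjoin_ne_zero (finite_coordSet u v) h h0
    refine hφ0 ?_
    rw [← hφ]
    exact hf _ ⟨_, ⟨_, pointOfHom_mem_locus u hv φ, rfl⟩, rfl⟩
  let ψ := Ideal.Quotient.liftₐ
    (MvPolynomial.vanishingIdeal K (GPoint.coords '' (matrixAction C '' locus K u v)))
    (MvPolynomial.aeval w) hvan
  obtain ⟨I, hI, hIc⟩ := (AlgebraicIndependent.matroid K F).exists_isBasis' (Set.range w)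
    |>.imp fun I hI => And.intro hI hI.encard_eq_eRk
  rw [← hIc] at hr
  have hind : AlgebraicIndependent K ((↑) : I → F) := hI.indep
  have hlift : ∀ x : I, ∃ y, ψ y = x := by
    rintro ⟨x, hx⟩
    obtain ⟨i, rfl⟩ := hI.subset hx
    exact ⟨Ideal.Quotient.mk _ (MvPolynomial.X i), by
      simp only [ψ]
      erw [Ideal.Quotient.liftₐ_apply, Ideal.Quotient.lift_mk]
      simp⟩
  choose y hy using hlift
  have hyind : AlgebraicIndependent K y := by
    refine AlgebraicIndependent.of_comp ψ ?_
    convert hind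
    exact funext hy
  have h1 := hyind.cardinalMk_le_trdeg
  refine le_trans ?_ h1
  have hfin : I.Finite := (Set.finite_range w).subset hI.subset
  rw [hfin.encard_eq_coe_toFinset_card, Nat.cast_le] at hr
  have := hfin.fintype
  rw [Cardinal.mk_fintype, Nat.cast_le, ← Set.toFinset_card]
  convert hr
  ext
  simp

/-- The existential closedness axiom in terms of a generic point: if the locus of `(u, v)` is free
and rotund, then some point `(a, exp a)` is a specialisation of `(u, v)`. -/
theorem ExistentialClosedness.exists_specialization {e : AddChar K Kˣ}
    (hEC : ExistentialClosedness e) (hk : 1 ≤ k) (u : Fin k → F) {v : Fin k → F}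
    (hv : ∀ i, v i ≠ 0)
    (hadd : ∀ m : Fin k → ℤ, m ≠ 0 → ∀ b : K, ∑ i, (m i : F) * u i ≠ algebraMap K F b)
    (hmul : ∀ m : Fin k → ℤ, m ≠ 0 → ∀ b : K, ∏ i, v i ^ m i ≠ algebraMap K F b)
    (hrot : ∀ r : ℕ, ∀ C : Matrix (Fin r) (Fin k) ℤ, 1 ≤ r → (C.map (Int.cast : ℤ → ℚ)).rank = r →
      (r : ℕ∞) ≤ (AlgebraicIndependent.matroid K F).eRk
        (Set.range (Sum.elim (fun i => ∑ j, (C i j : F) * u j) (fun i => ∏ j, v j ^ C i j)))) :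
    ∃ a : Fin k → K, ∀ f : MvPolynomial (Fin k ⊕ Fin k) K,
      MvPolynomial.aeval (Sum.elim u v) f = 0 →
      MvPolynomial.eval (Sum.elim a (fun i => (e (a i) : K))) f = 0 := by
  have hsub : ∀ m : Fin k → ℤ, ∀ f : MvPolynomial (Fin 1 ⊕ Fin 1) K,
      (∀ P ∈ locus K u v,
        MvPolynomial.eval (matrixAction (Matrix.of fun _ : Fin 1 => m) P).coords f = 0) →
      MvPolynomial.aeval (Sum.elim (fun _ : Fin 1 => ∑ j, (m j : F) * u j)
        (fun _ : Fin 1 => ∏ j, v j ^ m j)) f = 0 := by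
    intro m f hf
    by_contra h0
    obtain ⟨h, hφ⟩ := eval_matrixAction_pointOfHom u hv (Matrix.of fun _ : Fin 1 => m) f
    obtain ⟨φ, hφ0⟩ := exists_algHom_adjoin_ne_zero (finite_coordSet u v) h h0
    refine hφ0 ?_
    rw [← hφ]
    exact hf _ (pointOfHom_mem_locus u hv φ)
  have hinf := hEC k hk (locus K u v) (isIrreducibleGVariety_locus u hv)
    (fun r hr1 _ C hC => eRk_le_gDim_matrixAction u hv C (hrot r C hr1 hC)) (by
      intro m hm b
      constructor
      · intro hV
        have h := hsub m (MvPolynomial.X (Sum.inr 0) - MvPolynomial.C b) (by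
          intro P hP
          have h1 := hV hP
          simp only [Set.mem_ofPred_eq] at h1
          simp [GPoint.coords, matrixAction, h1])
        refine hmul m hm b ?_
        simpa [sub_eq_zero] using h
      · intro hV
        have h := hsub m (MvPolynomial.X (Sum.inl 0) - MvPolynomial.C b) (by
          intro P hP
          have h1 := hV hP
          simp only [Set.mem_ofPred_eq] at h1
          simp [GPoint.coords, matrixAction, h1])
        refine hadd m hm b ?_
        simpa [sub_eq_zero] using h)
  obtain ⟨a, ha⟩ := hinf.nonempty
  exact ⟨a, fun f hf => ha f hf⟩

end Locus

/-! ### The matroid of algebraic independence -/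

section AlgClosureOfSet

variable {K F : Type*} [Field K] [Field F] [Algebra K F]

open AlgebraicIndependent

/-- The elements of `F` that are algebraic over the subfield generated by `s` over `K`: the closure
of `s` in the matroid of algebraic independence. -/
def acl (K : Type*) {F : Type*} [Field K] [Field F] [Algebra K F] (s : Set F) :
    IntermediateField K F where
  __ := (Subalgebra.algebraicClosure (Algebra.adjoin K s) F).restrictScalars K
  inv_mem' := fun _ hx => IsAlgebraic.inv hx

theorem coe_acl (s : Set F) : (acl K s : Set F) = (matroid K F).closure s :=
  matroid_closure_eq.symm

theorem subset_acl (s : Set F) : s ⊆ acl K s := by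
  rw [coe_acl]
  exact (matroid K F).subset_closure s (Set.subset_univ s)

theorem acl_le_acl {s t : Set F} (h : s ⊆ acl K t) : acl K s ≤ acl K t := by
  rw [← SetLike.coe_subset_coe, coe_acl, coe_acl]
  rw [coe_acl] at h
  exact (matroid K F).closure_subset_closure_of_subset_closure h

theorem acl_mono {s t : Set F} (h : s ⊆ t) : acl K s ≤ acl K t :=
  acl_le_acl (h.trans (subset_acl t))

theorem mem_acl_of_pow_mem {s : Set F} {a : F} {N : ℕ} (hN : 0 < N) (h : a ^ N ∈ acl K s) :
    a ∈ acl K s :=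
  IsAlgebraic.of_pow hN h

theorem mem_acl_of_zpow_mem {s : Set F} {a : F} {N : ℤ} (hN : N ≠ 0) (h : a ^ N ∈ acl K s) :
    a ∈ acl K s := by
  refine mem_acl_of_pow_mem (Int.natAbs_pos.mpr hN) ?_
  rcases Int.natAbs_eq N with h1 | h1
  · rwa [h1, zpow_natCast] at h
  · rw [h1, zpow_neg, zpow_natCast] at h
    exact inv_mem_iff.mp h

theorem exists_algebraMap_eq_of_isAlgebraic [IsAlgClosed K] {a : F} (ha : IsAlgebraic K a) :
    ∃ b : K, algebraMap K F b = a := by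
  have := IntermediateField.isAlgebraic_adjoin_simple ha.isIntegral
  obtain ⟨b, hb⟩ := (IsAlgClosed.algebraMap_bijective_of_isIntegral (k := K)
    (K := IntermediateField.adjoin K {a})).2 (IntermediateField.AdjoinSimple.gen K a)
  exact ⟨b, congrArg Subtype.val hb⟩

theorem eRk_singleton_eq_one [IsAlgClosed K] {a : F} (ha : ∀ b : K, a ≠ algebraMap K F b) :
    (matroid K F).eRk {a} = 1 := by
  rw [Matroid.eRk_singleton_eq_one_iff, ← Matroid.indep_singleton, matroid_indep_iff]
  refine (algebraicIndependent_singleton_iff (⟨a, rfl⟩ : ({a} : Set F))).mpr fun halg => ?_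
  obtain ⟨b, hb⟩ := exists_algebraMap_eq_of_isAlgebraic halg
  exact ha b hb.symm

end AlgClosureOfSet

/-! ### Rotundity of loci of corank one -/

section Rotund

theorem exists_int_mul_eq {ι : Type*} [Finite ι] (c : ι → ℚ) :
    ∃ N : ℤ, N ≠ 0 ∧ ∃ m : ι → ℤ, ∀ i, (m i : ℚ) = N * c i := by
  obtain ⟨⟨N, hN⟩, h⟩ := IsLocalization.exist_integer_multiples_of_finite (nonZeroDivisors ℤ) c
  choose m hm using h
  exact ⟨N, nonZeroDivisors.ne_zero hN, m, fun i => by simpa using hm i⟩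

variable {K F : Type*} [Field K] [Field F] [Algebra K F] {k : ℕ}

/-- The rational exponent vectors `q` for which some power of the monomial `v ^ q` with integral
exponents is algebraic over `s`. -/
def aclExponents (K : Type*) {F : Type*} [Field K] [Field F] [Algebra K F] {k : ℕ} (s : Set F)
    {v : Fin k → F} (hv : ∀ i, v i ≠ 0) : Submodule ℚ (Fin k → ℚ) where
  carrier := {q | ∃ N : ℤ, N ≠ 0 ∧ ∃ m : Fin k → ℤ, (∀ i, (m i : ℚ) = N * q i) ∧
    ∏ i, v i ^ m i ∈ acl K s}
  zero_mem' := ⟨1, one_ne_zero, 0, by simp, by simp⟩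
  add_mem' := by
    rintro q q' ⟨N, hN, m, hm, h⟩ ⟨N', hN', m', hm', h'⟩
    refine ⟨N * N', mul_ne_zero hN hN', fun i => N' * m i + N * m' i, fun i => ?_, ?_⟩
    · push_cast
      rw [hm, hm', Pi.add_apply]
      ring
    · have h1 := mul_mem (zpow_mem h N') (zpow_mem h' N)
      rw [← Finset.prod_zpow, ← Finset.prod_zpow, ← Finset.prod_mul_distrib] at h1
      convert h1 using 2 with i
      rw [zpow_add₀ (hv i), mul_comm N', zpow_mul, mul_comm N, zpow_mul]
  smul_mem' := by
    rintro a q ⟨N, hN, m, hm, h⟩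
    refine ⟨a.den * N, mul_ne_zero (by exact_mod_cast a.den_nz) hN, fun i => a.num * m i,
      fun i => ?_, ?_⟩
    · push_cast
      rw [hm, Pi.smul_apply, smul_eq_mul]
      linear_combination (-(N : ℚ) * q i) * Rat.mul_den_eq_num a
    · have h1 := zpow_mem h a.num
      rw [← Finset.prod_zpow] at h1
      convert h1 using 2 with i
      rw [← zpow_mul, mul_comm (m i)]

theorem mem_acl_of_single_mem_aclExponents {s : Set F} {v : Fin k → F} (hv : ∀ i, v i ≠ 0)
    {i : Fin k} (h : Pi.single i 1 ∈ aclExponents K s hv) : v i ∈ acl K s := by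
  obtain ⟨N, hN, m, hm, h⟩ := h
  have h1 : m = Pi.single i N := by
    funext j
    have := hm j
    by_cases hj : j = i
    · subst hj
      simpa using this
    · simpa [Pi.single_eq_of_ne hj] using this
  refine mem_acl_of_zpow_mem hN ?_
  convert h
  rw [Finset.prod_eq_single i]
  · simp [h1]
  · intro j _ hj
    simp [h1, Pi.single_eq_of_ne hj]
  · simp

theorem mem_aclExponents_of_mem {s : Set F} {v : Fin k → F} (hv : ∀ i, v i ≠ 0) {m : Fin k → ℤ}
    (h : ∏ i, v i ^ m i ∈ acl K s) : (fun i => (m i : ℚ)) ∈ aclExponents K s hv :=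
  ⟨1, one_ne_zero, m, by simp, h⟩

/-- A nonzero subspace `W` of `ℚ^k` contains a nonzero vector `c` supported on the first `N + 1`
coordinates, such that the first `N` unit vectors extend by further unit vectors to a basis of a
complement of `W`. -/
theorem exists_complement_of_ne_bot (W : Submodule ℚ (Fin k → ℚ)) (hW : W ≠ ⊥) :
    ∃ N : ℕ, ∃ c ∈ W, c ≠ 0 ∧ (∀ j : Fin k, N < j → c j = 0) ∧
      ∃ J : Set (Fin k), (∀ j : Fin k, (j : ℕ) < N → j ∈ J) ∧
        J.ncard + Module.finrank ℚ W = k ∧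
        W ⊔ Submodule.span ℚ ((fun j => (Pi.single j 1 : Fin k → ℚ)) '' J) = ⊤ := by
  classical
  have hex : ∃ N : ℕ, ∃ c ∈ W, c ≠ 0 ∧ ∀ j : Fin k, N ≤ j → c j = 0 := by
    obtain ⟨c, hc, hc0⟩ := Submodule.exists_mem_ne_zero_of_ne_bot hW
    exact ⟨k, c, hc, hc0, fun j hj => absurd j.2 (not_lt.mpr hj)⟩
  obtain ⟨N, hN⟩ : ∃ N, Nat.find hex = N + 1 := by
    refine Nat.exists_eq_succ_of_ne_zero fun h0 => ?_
    obtain ⟨c, _, hc0, hc⟩ := Nat.find_spec hex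
    exact hc0 (funext fun j => hc j (h0 ▸ Nat.zero_le _))
  obtain ⟨c, hcW, hc0, hc⟩ := Nat.find_spec hex
  rw [hN] at hc
  have hmin : ∀ d ∈ W, (∀ j : Fin k, N ≤ j → d j = 0) → d = 0 := by
    intro d hd hdj
    by_contra hd0
    exact Nat.find_min hex (hN ▸ Nat.lt_succ_self N) ⟨d, hd, hd0, hdj⟩
  have hsup : ∀ d ∈ Submodule.span ℚ
      ((fun j => (Pi.single j 1 : Fin k → ℚ)) '' {j : Fin k | (j : ℕ) < N}),
      ∀ j : Fin k, N ≤ j → d j = 0 := by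
    intro d hd j hj
    induction hd using Submodule.span_induction with
    | mem d hd =>
      obtain ⟨i, hi, rfl⟩ := hd
      exact Pi.single_eq_of_ne (fun h => absurd hi (by simp [← h, hj])) _
    | zero => rfl
    | add d d' _ _ h h' => simp [h, h']
    | smul a d _ h => simp [h]
  have hli : LinearIndepOn ℚ (fun j => W.mkQ (Pi.single j 1 : Fin k → ℚ))
      {j : Fin k | (j : ℕ) < N} := by
    have h1 : LinearIndepOn ℚ (fun j => (Pi.single j 1 : Fin k → ℚ))
        {j : Fin k | (j : ℕ) < N} := by
      have h2 := (Pi.basisFun ℚ (Fin k)).linearIndependent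
      have h3 : LinearIndependent ℚ (fun j => (Pi.single j 1 : Fin k → ℚ)) := by
        convert h2 with j
        simp
      exact h3.linearIndepOn _
    refine h1.map ?_
    rw [Submodule.ker_mkQ, Submodule.disjoint_def]
    rw [Set.image_eq_range] at hsup
    exact fun d hd hdW => hmin d hdW (hsup d hd)
  have hspan : Submodule.span ℚ ((fun j => W.mkQ (Pi.single j 1 : Fin k → ℚ)) ''
      hli.extend (Set.subset_univ _)) = ⊤ := by
    rw [hli.span_image_extend_eq_span_image, Set.image_univ,
      show (fun j => W.mkQ (Pi.single j 1 : Fin k → ℚ)) =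
        W.mkQ ∘ (fun j => (Pi.single j 1 : Fin k → ℚ)) from rfl, Set.range_comp,
      Submodule.span_image]
    have h2 := (Pi.basisFun ℚ (Fin k)).span_eq
    have h3 : ⇑(Pi.basisFun ℚ (Fin k)) = fun j => (Pi.single j 1 : Fin k → ℚ) := by
      funext j
      simp
    rw [h3] at h2
    rw [h2, Submodule.map_top, Submodule.range_mkQ]
  refine ⟨N, c, hcW, hc0, fun j hj => hc j hj, hli.extend (Set.subset_univ _),
    fun j hj => hli.subset_extend _ hj, ?_, ?_⟩
  · have h1 := finrank_span_eq_card (hli.linearIndepOn_extend (Set.subset_univ _))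
    rw [Set.image_eq_range] at hspan
    rw [hspan, finrank_top, ← Nat.card_eq_fintype_card,
      Nat.card_coe_set_eq] at h1
    rw [← h1, Submodule.finrank_quotient_add_finrank, Module.finrank_fin_fun]
  · rw [← Submodule.comap_map_mkQ, ← Submodule.span_image, Set.image_image, hspan,
      Submodule.comap_top]

open AlgebraicIndependent in
/-- Rotundity of the locus of `(u, v)` when `u i` is algebraic over `x` and the `v j` with `j < i`,
provided the locus is additively free and has codimension at most one in the `(x, v)`-space: a
relation among the monomials `v ^ C` cuts down the dimension of the image by at most one, and some
combination of the rows of `C` gives a nonconstant function that depends on few coordinates. -/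
theorem le_eRk_range_matrix [CharZero K] [IsAlgClosed K] {n : ℕ} (x : Fin n → F)
    (u : Fin k → F) {v : Fin k → F} (hv : ∀ i, v i ≠ 0)
    (hadd : ∀ m : Fin k → ℤ, m ≠ 0 → ∀ b : K, ∑ i, (m i : F) * u i ≠ algebraMap K F b)
    (hu : ∀ i, u i ∈ acl K (Set.range x ∪ v '' {j | j < i}))
    (hrk : ((n + k : ℕ) : ℕ∞) ≤ (matroid K F).eRk (Set.range x ∪ Set.range v) + 1)
    {r : ℕ} (C : Matrix (Fin r) (Fin k) ℤ) (hr : 1 ≤ r)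
    (hC : (C.map (Int.cast : ℤ → ℚ)).rank = r) :
    (r : ℕ∞) ≤ (matroid K F).eRk
      (Set.range (Sum.elim (fun i => ∑ j, (C i j : F) * u j) (fun i => ∏ j, v j ^ C i j))) := by
  have : CharZero F := charZero_of_injective_algebraMap (algebraMap K F).injective
  set S := Set.range (Sum.elim (fun i => ∑ j, (C i j : F) * u j) (fun i => ∏ j, v j ^ C i j))
    with hS
  set W : Submodule ℚ (Fin k → ℚ) := Submodule.span ℚ (Set.range (C.map (Int.cast : ℤ → ℚ)).row)
    with hW
  have hWr : Module.finrank ℚ W = r := by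
    rw [← hC, Matrix.rank_eq_finrank_span_row]
  obtain ⟨N, c, hcW, hc0, hcN, J, hJ, hJc, hJW⟩ := exists_complement_of_ne_bot W (by
    intro h0
    rw [h0, finrank_bot] at hWr
    omega)
  -- The combination `s` of the additive coordinates with coefficients `c`.
  set s : F := ∑ i, (c i : F) * u i with hs
  have hsS : s ∈ acl K S := by
    have key : ∀ d ∈ W, ∑ i, (d i : F) * u i ∈ acl K S := by
      intro d hd
      induction hd using Submodule.span_induction with
      | mem d hd =>
        obtain ⟨l, rfl⟩ := hd
        exact subset_acl S ⟨Sum.inl l, by simp [Matrix.row]⟩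
      | zero => simp
      | add d d' _ _ h h' =>
        convert add_mem h h' using 1
        rw [← Finset.sum_add_distrib]
        exact Finset.sum_congr rfl fun i _ => by simp [add_mul]
      | smul a d _ h =>
        have ha : (a : F) ∈ acl K S := by
          exact SubfieldClass.ratCast_mem _ a
        convert mul_mem ha h using 1
        rw [Finset.mul_sum]
        exact Finset.sum_congr rfl fun i _ => by simp [mul_assoc]
    exact key c hcW
  have hs1 : ∀ b : K, s ≠ algebraMap K F b := by
    intro b hb
    obtain ⟨M, hM, m, hm⟩ := exists_int_mul_eq c
    refine hadd m ?_ (M * b) ?_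
    · rintro rfl
      refine hc0 (funext fun i => ?_)
      have := hm i
      simpa [hM] using this
    · rw [map_mul, ← hb, hs, Finset.mul_sum]
      refine Finset.sum_congr rfl fun i _ => ?_
      have h1 : ((m i : ℚ) : F) = ((M * c i : ℚ) : F) := by rw [hm]
      push_cast at h1
      rw [h1]
      simp [mul_assoc]
  -- `X` consists of the coordinates `x` and the `v j` complementary to the rows of `C`.
  set X : Set F := Set.range x ∪ v '' J with hX
  have hsX : s ∈ acl K X := by
    refine sum_mem fun i _ => ?_
    by_cases hi : N < (i : ℕ)
    · simp [hcN i hi]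
    · refine mul_mem (SubfieldClass.ratCast_mem _ _) (acl_mono ?_ (hu i))
      refine Set.union_subset_union_right _ (Set.image_mono fun j hj => hJ j ?_)
      have : (j : ℕ) < i := hj
      omega
  have hvXS : Set.range x ∪ Set.range v ⊆ acl K (X ∪ S) := by
    refine Set.union_subset (Set.subset_union_left.trans (Set.subset_union_left.trans
      (subset_acl _))) ?_
    rintro _ ⟨i, rfl⟩
    refine mem_acl_of_single_mem_aclExponents hv ?_
    have htop : aclExponents K (X ∪ S) hv = ⊤ := by
      rw [eq_top_iff, ← hJW, sup_le_iff, hW, Submodule.span_le, Submodule.span_le]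
      constructor
      · rintro _ ⟨l, rfl⟩
        exact mem_aclExponents_of_mem hv (m := C l)
          (subset_acl _ (Or.inr ⟨Sum.inr l, by simp⟩))
      · rintro _ ⟨j, hj, rfl⟩
        have h1 := mem_aclExponents_of_mem (K := K) (s := X ∪ S) hv (m := Pi.single j 1) (by
          rw [Finset.prod_eq_single j]
          · simpa using subset_acl (K := K) (X ∪ S) (Or.inl (Or.inr ⟨j, hj, rfl⟩))
          · intro i _ hi
            simp [Pi.single_eq_of_ne hi]
          · simp)
        have h2 : (fun i => ((Pi.single j 1 : Fin k → ℤ) i : ℚ)) = Pi.single j 1 := by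
          funext i
          by_cases hi : i = j
          · subst hi; simp
          · simp [Pi.single_eq_of_ne hi]
        rwa [h2] at h1
    rw [htop]
    trivial
  have hle : (matroid K F).eRk (Set.range x ∪ Set.range v) ≤
      (matroid K F).eRk ((matroid K F).closure X ∪ (matroid K F).closure S) := by
    rw [Matroid.eRk_union_closure_left_eq, Matroid.eRk_union_closure_right_eq,
      ← Matroid.eRk_closure_eq _ (X ∪ S)]
    refine Matroid.eRk_mono _ ?_
    rw [← coe_acl]
    exact hvXS
  have hge : 1 ≤ (matroid K F).eRk ((matroid K F).closure X ∩ (matroid K F).closure S) := by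
    rw [← eRk_singleton_eq_one hs1]
    refine Matroid.eRk_mono _ (Set.singleton_subset_iff.mpr ?_)
    rw [← coe_acl, ← coe_acl]
    exact ⟨hsX, hsS⟩
  have hXc : (matroid K F).eRk X ≤ ((n + J.ncard : ℕ) : ℕ∞) := by
    refine (Matroid.eRk_le_encard _ _).trans ((Set.encard_union_le _ _).trans ?_)
    push_cast
    refine add_le_add ?_ ?_
    · rw [← Set.image_univ]
      refine (Set.encard_image_le _ _).trans ?_
      simp
    · refine (Set.encard_image_le _ _).trans ?_
      rw [Set.Finite.cast_ncard_eq (Set.toFinite J)]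
  have hsub := (matroid K F).eRk_submod ((matroid K F).closure X) ((matroid K F).closure S)
  rw [Matroid.eRk_closure_eq, Matroid.eRk_closure_eq] at hsub
  have h1 : ((n + k : ℕ) : ℕ∞) ≤ ((n + J.ncard : ℕ) : ℕ∞) + (matroid K F).eRk S :=
    calc ((n + k : ℕ) : ℕ∞) ≤ (matroid K F).eRk (Set.range x ∪ Set.range v) + 1 := hrk
      _ ≤ _ := add_le_add hle hge
      _ ≤ _ := by rw [add_comm]; exact hsub
      _ ≤ _ := add_le_add hXc le_rfl
  cases hR : (matroid K F).eRk S with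
  | top => exact le_top
  | coe R =>
    rw [hR] at h1
    norm_cast at h1 ⊢
    omega

end Rotund

/-! ### Variables of polynomials -/

section PolynomialVars

variable {σ K : Type*} [Field K]

open MvPolynomial

theorem vars_subset_vars_of_dvd {p q : MvPolynomial σ K} (hpq : p ∣ q) (hq : q ≠ 0) :
    p.vars ⊆ q.vars := by
  classical
  obtain ⟨r, rfl⟩ := hpq
  intro i hi
  have hp0 : p ≠ 0 := left_ne_zero_of_mul hq
  have hr0 : r ≠ 0 := right_ne_zero_of_mul hq
  rw [vars_def, Multiset.mem_toFinset, ← Multiset.count_pos, ← degreeOf_def] at hi ⊢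
  rw [degreeOf_mul_eq hp0 hr0]
  omega

theorem eqOn_supported {R : Type*} [CommRing R] [Algebra K R] {s : Set σ}
    {f g : MvPolynomial σ K →ₐ[K] R} (h : ∀ i ∈ s, f (X i) = g (X i)) {p : MvPolynomial σ K}
    (hp : p ∈ supported K s) : f p = g p := by
  have hle : supported K s ≤ AlgHom.equalizer f g := by
    rw [supported_eq_adjoin_X, Algebra.adjoin_le_iff]
    rintro _ ⟨i, hi, rfl⟩
    exact h i hi
  exact hle hp

end PolynomialVars

/-! ### The Laurent ring -/

section Laurent

variable (K : Type u) [Field K] (n α : ℕ)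

/-- The product of the variables that are inverted in the Laurent ring. -/
def invertedProd : MvPolynomial (Fin n ⊕ Fin α) K := ∏ i : Fin α, MvPolynomial.X (Sum.inr i)

/-- The ring of polynomials in `x₁, …, xₙ` and Laurent polynomials in `v₁, …, v_α`. The variable
`vᵢ` stands for the exponential of an exponential polynomial. -/
abbrev LaurentRing : Type u := Localization.Away (invertedProd K n α)

theorem invertedProd_ne_zero : invertedProd K n α ≠ 0 :=
  Finset.prod_ne_zero_iff.mpr fun _ _ => MvPolynomial.X_ne_zero _

instance : IsDomain (LaurentRing K n α) :=
  IsLocalization.isDomain_localization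
    (powers_le_nonZeroDivisors_of_noZeroDivisors (invertedProd_ne_zero K n α))

namespace LaurentRing

variable {K n α}

/-- The inclusion of the polynomial ring. -/
def ofPoly : MvPolynomial (Fin n ⊕ Fin α) K →ₐ[K] LaurentRing K n α :=
  IsScalarTower.toAlgHom K _ _

/-- The variable `xⱼ`. -/
def x (j : Fin n) : LaurentRing K n α := ofPoly (MvPolynomial.X (Sum.inl j))

theorem isUnit_ofPoly_X (i : Fin α) :
    IsUnit (ofPoly (MvPolynomial.X (Sum.inr i)) : LaurentRing K n α) := by
  have h1 : IsUnit (ofPoly (invertedProd K n α) : LaurentRing K n α) :=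
    IsLocalization.Away.algebraMap_isUnit _
  exact isUnit_of_dvd_unit (map_dvd _ (Finset.dvd_prod_of_mem
    (fun i : Fin α => (MvPolynomial.X (Sum.inr i) : MvPolynomial (Fin n ⊕ Fin α) K))
    (Finset.mem_univ i))) h1

/-- The invertible variable `vᵢ`, as a unit. -/
def vUnit (i : Fin α) : (LaurentRing K n α)ˣ := (isUnit_ofPoly_X i).unit

/-- The invertible variable `vᵢ`. -/
def v (i : Fin α) : LaurentRing K n α := ofPoly (MvPolynomial.X (Sum.inr i))

theorem coe_vUnit (i : Fin α) : ((vUnit i : (LaurentRing K n α)ˣ) : LaurentRing K n α) = v i :=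
  rfl

variable {R : Type*} [CommRing R] [Algebra K R]

/-- The homomorphism with prescribed values at the variables. -/
def lift (a : Fin n → R) (b : Fin α → Rˣ) : LaurentRing K n α →ₐ[K] R :=
  IsLocalization.liftAlgHom (M := Submonoid.powers (invertedProd K n α))
    (f := MvPolynomial.aeval (Sum.elim a (fun i => (b i : R)))) (by
      rintro ⟨_, N, rfl⟩
      simp only [map_pow, invertedProd, map_prod, MvPolynomial.aeval_X, Sum.elim_inr]
      rw [← Units.coe_prod]
      exact (Units.isUnit _).pow N)

theorem lift_ofPoly (a : Fin n → R) (b : Fin α → Rˣ) (f : MvPolynomial (Fin n ⊕ Fin α) K) :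
    lift a b (ofPoly f) = MvPolynomial.aeval (Sum.elim a (fun i => (b i : R))) f :=
  IsLocalization.lift_eq _ f

theorem lift_x (a : Fin n → R) (b : Fin α → Rˣ) (j : Fin n) :
    lift (K := K) a b (x j) = a j := by
  simp [x, lift_ofPoly]

theorem lift_v (a : Fin n → R) (b : Fin α → Rˣ) (i : Fin α) :
    lift (K := K) a b (v i) = b i := by
  simp [v, lift_ofPoly]

theorem algHom_ext {f g : LaurentRing K n α →ₐ[K] R} (hx : ∀ j, f (x j) = g (x j))
    (hv : ∀ i, f (v i) = g (v i)) : f = g := by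
  refine IsLocalization.algHom_ext (Submonoid.powers (invertedProd K n α)) ?_
  apply MvPolynomial.algHom_ext
  rintro (j | i)
  · exact hx j
  · exact hv i

/-- The variables `xⱼ`, and `vᵢ` with `i < k`. -/
def lowVars (n α k : ℕ) : Set (Fin n ⊕ Fin α) := {s | ∀ i, s = Sum.inr i → (i : ℕ) < k}

theorem inl_mem_lowVars (k : ℕ) (j : Fin n) : Sum.inl j ∈ lowVars n α k := by
  intro i hi
  cases hi

theorem inr_mem_lowVars {k : ℕ} {i : Fin α} : Sum.inr i ∈ lowVars n α k ↔ (i : ℕ) < k :=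
  ⟨fun h => h i rfl, fun h j hj => by cases hj; exact h⟩

theorem lowVars_mono {k l : ℕ} (h : k ≤ l) : lowVars n α k ⊆ lowVars n α l :=
  fun _ hs i hi => (hs i hi).trans_le h

/-- The subalgebra generated by the `xⱼ`, and the `vᵢ` and their inverses with `i < k`. -/
def lower (K : Type u) [Field K] (n α k : ℕ) : Subalgebra K (LaurentRing K n α) :=
  Algebra.adjoin K (Set.range x ∪ {g | ∃ i : Fin α, (i : ℕ) < k ∧
    (g = v i ∨ g = ((vUnit i)⁻¹ : (LaurentRing K n α)ˣ))})

theorem x_mem_lower (k : ℕ) (j : Fin n) : x j ∈ lower K n α k :=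
  Algebra.subset_adjoin (Or.inl ⟨j, rfl⟩)

theorem lower_mono {k l : ℕ} (h : k ≤ l) : lower K n α k ≤ lower K n α l := by
  refine Algebra.adjoin_mono (Set.union_subset_union_right _ ?_)
  rintro g ⟨i, hi, hg⟩
  exact ⟨i, hi.trans_le h, hg⟩

/-- The exponents of monomials in the `vᵢ` with `i < k`. -/
def IsLowExponent (k : ℕ) (d : Fin n ⊕ Fin α →₀ ℕ) : Prop :=
  ∀ s ∈ d.support, ∃ i : Fin α, s = Sum.inr i ∧ (i : ℕ) < k

theorem IsLowExponent.add {k : ℕ} {d d' : Fin n ⊕ Fin α →₀ ℕ} (h : IsLowExponent k d)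
    (h' : IsLowExponent k d') : IsLowExponent k (d + d') := by
  classical
  intro s hs
  rcases Finset.mem_union.mp (Finsupp.support_add hs) with hs | hs
  exacts [h s hs, h' s hs]

theorem isLowExponent_single {k : ℕ} {i : Fin α} (hi : (i : ℕ) < k) :
    IsLowExponent k (Finsupp.single (Sum.inr i : Fin n ⊕ Fin α) 1) := by
  intro s hs
  exact ⟨i, by simpa using Finsupp.support_single_subset hs, hi⟩

theorem monomial_mem_supported {k : ℕ} {d : Fin n ⊕ Fin α →₀ ℕ} (h : IsLowExponent k d) (c : K) :
    MvPolynomial.monomial d c ∈ MvPolynomial.supported K (lowVars n α k) := by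
  rw [MvPolynomial.mem_supported]
  intro s hs
  obtain ⟨e, he, hse⟩ := (MvPolynomial.mem_vars_iff_mem_support s).mp hs
  have he' := Finset.mem_singleton.mp (MvPolynomial.support_monomial_subset he)
  subst he'
  obtain ⟨i, rfl, hi⟩ := h s hse
  exact inr_mem_lowVars.mpr hi

/-- Monomials in the invertible variables are units. -/
theorem isUnit_ofPoly_monomial {k : ℕ} {d : Fin n ⊕ Fin α →₀ ℕ} (h : IsLowExponent k d) :
    IsUnit (ofPoly (MvPolynomial.monomial d 1) : LaurentRing K n α) := by
  rw [MvPolynomial.monomial_eq, Finsupp.prod, map_mul, map_one, map_one, one_mul, map_prod]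
  refine (Submonoid.prod_mem (IsUnit.submonoid _) fun s hs => ?_)
  obtain ⟨i, rfl, _⟩ := h s hs
  rw [map_pow]
  exact (isUnit_ofPoly_X i).pow _

/-- Clearing denominators. -/
theorem exists_mul_monomial_eq {k : ℕ} {g : LaurentRing K n α} (hg : g ∈ lower K n α k) :
    ∃ p ∈ MvPolynomial.supported K (lowVars n α k), ∃ d : Fin n ⊕ Fin α →₀ ℕ, IsLowExponent k d ∧
      ofPoly p = g * ofPoly (MvPolynomial.monomial d 1) := by
  have h0 : IsLowExponent k (0 : Fin n ⊕ Fin α →₀ ℕ) := fun s hs => by simp at hs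
  have hone : (MvPolynomial.monomial 0 1 : MvPolynomial (Fin n ⊕ Fin α) K) = 1 := rfl
  have hmul : ∀ d d' : Fin n ⊕ Fin α →₀ ℕ,
      (MvPolynomial.monomial (d + d') 1 : MvPolynomial (Fin n ⊕ Fin α) K) =
        MvPolynomial.monomial d 1 * MvPolynomial.monomial d' 1 := fun d d' => by
    rw [MvPolynomial.monomial_mul, one_mul]
  induction hg using Algebra.adjoin_induction with
  | mem g hg =>
    rcases hg with ⟨j, rfl⟩ | ⟨i, hi, rfl | rfl⟩
    · exact ⟨MvPolynomial.X (Sum.inl j),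
        MvPolynomial.X_mem_supported.mpr (inl_mem_lowVars k j), 0, h0, by
          rw [hone, map_one, mul_one]; rfl⟩
    · exact ⟨MvPolynomial.X (Sum.inr i),
        MvPolynomial.X_mem_supported.mpr (inr_mem_lowVars.mpr hi), 0, h0, by
          rw [hone, map_one, mul_one]; rfl⟩
    · exact ⟨1, one_mem _, Finsupp.single (Sum.inr i) 1, isLowExponent_single hi, by
        rw [map_one]
        exact (Units.inv_mul (vUnit i)).symm⟩
  | algebraMap c =>
    exact ⟨MvPolynomial.C c, Subalgebra.algebraMap_mem _ c, 0, h0, by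
      rw [hone, map_one, mul_one]
      exact AlgHom.commutes _ c⟩
  | add g g' _ _ h h' =>
    obtain ⟨p, hp, d, hd, hpd⟩ := h
    obtain ⟨p', hp', d', hd', hpd'⟩ := h'
    refine ⟨p * MvPolynomial.monomial d' 1 + p' * MvPolynomial.monomial d 1,
      add_mem (mul_mem hp (monomial_mem_supported hd' 1))
        (mul_mem hp' (monomial_mem_supported hd 1)), d + d', hd.add hd', ?_⟩
    rw [map_add, map_mul, map_mul, hpd, hpd', hmul, map_mul]
    ring
  | mul g g' _ _ h h' =>
    obtain ⟨p, hp, d, hd, hpd⟩ := h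
    obtain ⟨p', hp', d', hd', hpd'⟩ := h'
    refine ⟨p * p', mul_mem hp hp', d + d', hd.add hd', ?_⟩
    rw [map_mul, hpd, hpd', hmul, map_mul]
    ring

/-- A nonzero polynomial all of whose prime factors divide invertible variables is a monomial in
these variables. -/
theorem exists_prime_dvd_or_eq_monomial {f : MvPolynomial (Fin n ⊕ Fin α) K} (hf : f ≠ 0) :
    (∃ P, Prime P ∧ P ∣ f ∧ ∀ i : Fin α, ¬ P ∣ MvPolynomial.X (Sum.inr i)) ∨
      ∃ d : Fin n ⊕ Fin α →₀ ℕ, IsLowExponent α d ∧ ∃ c : K, f = MvPolynomial.monomial d c := by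
  induction f using UniqueFactorizationMonoid.induction_on_prime with
  | h₁ => exact absurd rfl hf
  | h₂ f hu =>
    obtain ⟨c, _, rfl⟩ := MvPolynomial.isUnit_iff_eq_C_of_isReduced.mp hu
    exact Or.inr ⟨0, fun s hs => by simp at hs, c, rfl⟩
  | h₃ a p ha hp ih =>
    by_cases hpi : ∃ i : Fin α, p ∣ MvPolynomial.X (Sum.inr i)
    · obtain ⟨i, hi⟩ := hpi
      rcases ih ha with ⟨P, hP, hPa, hPv⟩ | ⟨d, hd, c, rfl⟩
      · exact Or.inl ⟨P, hP, hPa.mul_left p, hPv⟩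
      · right
        have hX : Prime (MvPolynomial.X (Sum.inr i) : MvPolynomial (Fin n ⊕ Fin α) K) :=
          MvPolynomial.X_prime
        obtain ⟨w, hw⟩ := (hp.associated_of_dvd hX hi).symm
        obtain ⟨b, _, hb⟩ := MvPolynomial.isUnit_iff_eq_C_of_isReduced.mp w.isUnit
        refine ⟨Finsupp.single (Sum.inr i) 1 + d, (isLowExponent_single i.2).add hd, b * c, ?_⟩
        rw [← hw, hb, mul_comm _ (MvPolynomial.C b), MvPolynomial.C_mul_X_eq_monomial,
          MvPolynomial.monomial_mul]
    · exact Or.inl ⟨p, hp, dvd_mul_right p a, not_exists.mp hpi⟩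

end LaurentRing

end Laurent

/-! ### The generic point of a hypersurface -/

section GenericPoint

open MvPolynomial LaurentRing

variable {K : Type u} [Field K] {n α : ℕ}

/-- The function field of the hypersurface `P = 0`, with the homomorphism from the Laurent ring that
gives its generic point. -/
theorem exists_algHom_field_of_prime {P : MvPolynomial (Fin n ⊕ Fin α) K} (hP : Prime P)
    (hPv : ∀ i : Fin α, ¬ P ∣ X (Sum.inr i)) :
    ∃ (F : Type u) (_ : Field F) (_ : Algebra K F) (χ : LaurentRing K n α →ₐ[K] F),
      ∀ f, χ (ofPoly f) = 0 ↔ P ∣ f := by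
  have hprime : (Ideal.span {P}).IsPrime := (Ideal.span_singleton_prime hP.ne_zero).mpr hP
  let D := MvPolynomial (Fin n ⊕ Fin α) K ⧸ Ideal.span {P}
  let F := FractionRing D
  let q : MvPolynomial (Fin n ⊕ Fin α) K →ₐ[K] F :=
    (IsScalarTower.toAlgHom K D F).comp (Ideal.Quotient.mkₐ K (Ideal.span {P}))
  have hq : ∀ f, q f = 0 ↔ P ∣ f := by
    intro f
    rw [← Ideal.mem_span_singleton, ← Ideal.Quotient.eq_zero_iff_mem]
    exact IsFractionRing.to_map_eq_zero_iff (R := D) (K := F)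
  have hv : ∀ i : Fin α, q (X (Sum.inr i)) ≠ 0 := fun i h => hPv i ((hq _).mp h)
  refine ⟨F, inferInstance, inferInstance,
    lift (fun j => q (X (Sum.inl j))) (fun i => Units.mk0 _ (hv i)), fun f => ?_⟩
  rw [lift_ofPoly, ← hq]
  have h1 : MvPolynomial.aeval (Sum.elim (fun j => q (X (Sum.inl j)))
      (fun i => ((Units.mk0 _ (hv i) : Fˣ) : F))) = q := by
    apply MvPolynomial.algHom_ext
    rintro (j | i) <;> simp
  rw [h1]

/-- On a hypersurface, the coordinates other than one that occurs in its equation are algebraically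
independent. -/
theorem algebraicIndependent_of_mem_vars {σ F : Type*} [Field F] [Algebra K F]
    {P : MvPolynomial σ K} {q : MvPolynomial σ K →ₐ[K] F} (hq : ∀ f, q f = 0 → P ∣ f) {z : σ}
    (hz : z ∈ P.vars) : AlgebraicIndependent K (fun y : {y // y ≠ z} => q (X y)) := by
  classical
  rw [algebraicIndependent_iff]
  intro f hf
  by_contra hf0
  have h1 : q (rename Subtype.val f) = 0 := by
    rw [← hf, ← AlgHom.comp_apply]
    congr 1
    apply MvPolynomial.algHom_ext
    intro i
    simp
  have h2 := vars_subset_vars_of_dvd (hq _ h1)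
    ((map_ne_zero_iff _ (rename_injective _ Subtype.val_injective)).mpr hf0) hz
  obtain ⟨y, _, hy⟩ := mem_vars_rename _ _ h2
  exact y.2 hy

/-- The monomial `v ^ m` with integral exponents. -/
def vMonomial (K : Type u) [Field K] (n : ℕ) {α : ℕ} (m : Fin α → ℤ) : (LaurentRing K n α)ˣ :=
  ∏ i, vUnit i ^ m i

theorem map_vMonomial {R : Type*} [CommRing R] [Algebra K R] (φ : LaurentRing K n α →ₐ[K] R)
    (m : Fin α → ℤ) : Units.map (φ : LaurentRing K n α →* R) (vMonomial K n m) =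
      ∏ i, Units.map (φ : LaurentRing K n α →* R) (vUnit i) ^ m i := by
  simp [vMonomial, map_prod, map_zpow]

theorem map_vMonomial_field {F : Type*} [Field F] [Algebra K F] (φ : LaurentRing K n α →ₐ[K] F)
    (m : Fin α → ℤ) : φ (vMonomial K n m) = ∏ i, φ (v i) ^ m i := by
  have h := congrArg Units.val (map_vMonomial φ m)
  simpa [coe_vUnit] using h

/-- If `m` is primitive, there is a retraction of the Laurent ring modulo `v ^ m = b`. -/
theorem exists_retraction {m l : Fin α → ℤ} (hl : ∑ i, l i * m i = 1) (b : Kˣ) :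
    ∃ ρ : LaurentRing K n α →ₐ[K] LaurentRing K n α,
      ρ (vMonomial K n m) = algebraMap K _ (b : K) ∧
      ∀ {R : Type u} [CommRing R] [Algebra K R] (φ : LaurentRing K n α →ₐ[K] R),
        φ (vMonomial K n m) = algebraMap K R (b : K) → φ.comp ρ = φ := by
  let bA : (LaurentRing K n α)ˣ := Units.map (algebraMap K (LaurentRing K n α) : K →* _) b
  let ρ : LaurentRing K n α →ₐ[K] LaurentRing K n α :=
    lift x (fun i => vUnit i * (bA * (vMonomial K n m)⁻¹) ^ l i)
  have hρv : ∀ i, Units.map (ρ : LaurentRing K n α →* LaurentRing K n α) (vUnit i) =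
      vUnit i * (bA * (vMonomial K n m)⁻¹) ^ l i := fun i => Units.ext (lift_v _ _ i)
  refine ⟨ρ, ?_, ?_⟩
  · have h1 := map_vMonomial ρ m
    simp_rw [hρv, mul_zpow, Finset.prod_mul_distrib] at h1
    have h2 : ∀ c : (LaurentRing K n α)ˣ, ∏ i, (c ^ l i) ^ m i = c := by
      intro c
      have h3 : ∀ s : Finset (Fin α), ∏ i ∈ s, (c ^ l i) ^ m i = c ^ (∑ i ∈ s, l i * m i) := by
        intro s
        induction s using Finset.cons_induction with
        | empty => simp
        | cons a s ha ih => rw [Finset.prod_cons, Finset.sum_cons, ih, zpow_add, zpow_mul]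
      rw [h3, hl, zpow_one]
    rw [h2, h2, ← vMonomial, mul_comm bA, mul_inv_cancel_left] at h1
    exact congrArg Units.val h1
  · intro R _ _ φ hφ
    have h1 : Units.map (φ : LaurentRing K n α →* R) (bA * (vMonomial K n m)⁻¹) = 1 := by
      rw [map_mul, map_inv, mul_inv_eq_one]
      ext
      simp only [Units.coe_map, bA, MonoidHom.coe_coe]
      rw [hφ]
      exact φ.commutes _
    refine algHom_ext (fun j => ?_) (fun i => ?_)
    · rw [AlgHom.comp_apply, lift_x]
    · have h2 := congrArg (Units.map (φ : LaurentRing K n α →* R)) (hρv i)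
      rw [map_mul, map_zpow, h1, one_zpow, mul_one] at h2
      exact congrArg Units.val h2

theorem exists_bezout {m : Fin α → ℤ} (hm : m ≠ 0) :
    ∃ d : ℤ, d ≠ 0 ∧ ∃ m' l : Fin α → ℤ, (∀ i, m i = d * m' i) ∧ ∑ i, l i * m' i = 1 := by
  obtain ⟨d, hd⟩ := (IsPrincipalIdealRing.principal (Ideal.span (Set.range m))).principal
  have h1 : ∀ i, ∃ c, m i = d * c := by
    intro i
    have : m i ∈ Ideal.span (Set.range m) := Ideal.subset_span ⟨i, rfl⟩
    rw [hd] at this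
    exact Ideal.mem_span_singleton.mp this
  choose m' hm' using h1
  have h2 : d ∈ Ideal.span (Set.range m) := by
    rw [hd]
    exact Ideal.mem_span_singleton_self d
  obtain ⟨l, hl⟩ := (Ideal.mem_span_range_iff_exists_fun).mp h2
  have hd0 : d ≠ 0 := by
    rintro rfl
    exact hm (funext fun i => by simp [hm'])
  refine ⟨d, hd0, m', l, hm', mul_left_cancel₀ hd0 ?_⟩
  rw [mul_one, Finset.mul_sum]
  conv_rhs => rw [← hl]
  exact Finset.sum_congr rfl fun i _ => by rw [hm' i]; ring

/-- A hypersurface on which a nontrivial monomial is constant is a coset of a codimension one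
subtorus: it contains every point at which some primitive monomial takes a certain value. -/
theorem exists_vMonomial_of_map_eq [CharZero K] [IsAlgClosed K] {F : Type u} [Field F] [Algebra K F]
    {P : MvPolynomial (Fin n ⊕ Fin α) K} (χ : LaurentRing K n α →ₐ[K] F)
    (hχ : ∀ f, χ (ofPoly f) = 0 ↔ P ∣ f) {m : Fin α → ℤ} (hm : m ≠ 0) {b : K}
    (hb : χ (vMonomial K n m) = algebraMap K F b) :
    ∃ m' : Fin α → ℤ, m' ≠ 0 ∧ (∀ i, m i = 0 → m' i = 0) ∧ ∃ b' : Kˣ,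
      ∀ φ : LaurentRing K n α →ₐ[K] K, φ (vMonomial K n m') = b' → φ (ofPoly P) = 0 := by
  obtain ⟨d, hd, m', l, hm', hl⟩ := exists_bezout hm
  have hw0 : χ (vMonomial K n m') ≠ 0 :=
    ((vMonomial K n m').isUnit.map χ).ne_zero
  have hpow : χ (vMonomial K n m') ^ d = algebraMap K F b := by
    rw [← hb, map_vMonomial_field, map_vMonomial_field, ← Finset.prod_zpow]
    exact Finset.prod_congr rfl fun i _ => by rw [hm' i, mul_comm d, zpow_mul]
  have halg : IsAlgebraic K (χ (vMonomial K n m')) := by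
    refine IsAlgebraic.of_pow (Int.natAbs_pos.mpr hd) ?_
    have h1 : IsAlgebraic K (χ (vMonomial K n m') ^ d) := hpow ▸ isAlgebraic_algebraMap b
    rcases Int.natAbs_eq d with h2 | h2
    · rwa [h2, zpow_natCast] at h1
    · rw [h2, zpow_neg, zpow_natCast] at h1
      exact (IsAlgebraic.inv_iff).mp h1
  obtain ⟨b₀, hb₀⟩ := exists_algebraMap_eq_of_isAlgebraic halg
  have hb₀0 : b₀ ≠ 0 := by
    rintro rfl
    exact hw0 (by rw [← hb₀, map_zero])
  obtain ⟨b', rfl⟩ : ∃ b' : Kˣ, (b' : K) = b₀ := ⟨Units.mk0 b₀ hb₀0, rfl⟩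
  refine ⟨m', ?_, fun i hi => ?_, b', ?_⟩
  · rintro rfl
    simp at hl
  · have := hm' i
    rw [hi] at this
    exact (mul_eq_zero.mp this.symm).resolve_left hd
  obtain ⟨ρ, hρ, hρφ⟩ := exists_retraction (K := K) (n := n) hl b'
  -- The monomial is not constant: it takes every nonzero value.
  have hne : ((vMonomial K n m' : (LaurentRing K n α)ˣ) : LaurentRing K n α) -
      algebraMap K _ (b' : K) ≠ 0 := by
    intro h0
    rw [sub_eq_zero] at h0
    obtain ⟨ρ', hρ', hρφ'⟩ := exists_retraction (K := K) (n := n) hl (b' * Units.mk0 2 two_ne_zero)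
    rw [h0, AlgHom.commutes] at hρ'
    have h1 := FaithfulSMul.algebraMap_injective K (LaurentRing K n α) hρ'
    rw [Units.val_mul, Units.val_mk0, eq_comm, mul_eq_left₀ b'.ne_zero] at h1
    norm_num at h1
  have hmem : ((vMonomial K n m' : (LaurentRing K n α)ˣ) : LaurentRing K n α) -
      algebraMap K _ (b' : K) ∈ lower K n α α := by
    refine sub_mem ?_ (Subalgebra.algebraMap_mem _ _)
    have h1 : ∀ i, ∀ N : ℤ, (((vUnit i ^ N : (LaurentRing K n α)ˣ)) : LaurentRing K n α) ∈
        lower K n α α := by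
      intro i N
      have h2 : v i ∈ lower K n α α := Algebra.subset_adjoin (Or.inr ⟨i, i.2, Or.inl rfl⟩)
      have h3 : (((vUnit i)⁻¹ : (LaurentRing K n α)ˣ) : LaurentRing K n α) ∈ lower K n α α :=
        Algebra.subset_adjoin (Or.inr ⟨i, i.2, Or.inr rfl⟩)
      cases N with
      | ofNat N =>
        rw [Int.ofNat_eq_natCast, zpow_natCast, Units.val_pow_eq_pow_val]
        exact pow_mem h2 N
      | negSucc N =>
        rw [zpow_negSucc, ← inv_pow, Units.val_pow_eq_pow_val]
        exact pow_mem h3 _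
    rw [vMonomial, Units.coe_prod]
    exact prod_mem fun i _ => h1 i _
  obtain ⟨p, _, D, hD, hpD⟩ := exists_mul_monomial_eq hmem
  have hχw : χ (((vMonomial K n m' : (LaurentRing K n α)ˣ) : LaurentRing K n α) -
      algebraMap K _ (b' : K)) = 0 := by
    rw [map_sub, AlgHom.commutes, hb₀, sub_self]
  obtain ⟨h, rfl⟩ := (hχ p).mp (by rw [hpD, map_mul, hχw, zero_mul])
  have hρ0 : ρ (ofPoly P) * ρ (ofPoly h) = 0 := by
    rw [← map_mul, ← map_mul, hpD, map_mul, map_sub, hρ, AlgHom.commutes, sub_self, zero_mul]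
  intro φ hφ
  rcases mul_eq_zero.mp hρ0 with h0 | h0
  · rw [← hρφ φ hφ, AlgHom.comp_apply, h0, map_zero]
  · -- Otherwise `P` would be a unit.
    exfalso
    let I : Ideal (LaurentRing K n α) :=
      Ideal.span {((vMonomial K n m' : (LaurentRing K n α)ˣ) : LaurentRing K n α) -
        algebraMap K _ (b' : K)}
    have hπ : (Ideal.Quotient.mkₐ K I).comp ρ = Ideal.Quotient.mkₐ K I := by
      refine hρφ _ ?_
      rw [← AlgHom.commutes (Ideal.Quotient.mkₐ K I), ← sub_eq_zero, ← map_sub]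
      exact Ideal.Quotient.eq_zero_iff_mem.mpr (Ideal.mem_span_singleton_self _)
    have hhI : ofPoly h ∈ I := by
      rw [← Ideal.Quotient.eq_zero_iff_mem]
      change Ideal.Quotient.mkₐ K I (ofPoly h) = 0
      rw [← hπ, AlgHom.comp_apply, h0, map_zero]
    obtain ⟨h', hh'⟩ := Ideal.mem_span_singleton.mp hhI
    rw [map_mul, hh', mul_left_comm] at hpD
    have h3 := congrArg χ (mul_left_cancel₀ hne hpD)
    rw [map_mul, (hχ P).mpr dvd_rfl, zero_mul] at h3
    exact ((isUnit_ofPoly_monomial hD).map χ).ne_zero h3.symm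

end GenericPoint

/-! ### Zeros in towers of exponentials -/

section Tower

open MvPolynomial LaurentRing

variable {K : Type u} [Field K] {n α : ℕ}

/-- A tower of exponentials: elements `τ₀, …, τ_{α-1}` of the Laurent ring, linearly independent
over `ℤ` modulo constants, such that `vᵢ` is to be thought of as `exp τᵢ`. The first `n` of them are
proportional to the variables `xⱼ`, and `τᵢ` involves only the `vⱼ` with `j < i`. The maps `ev a` are
the evaluations with `xⱼ ↦ aⱼ` that respect these exponentials. -/
structure IsExpTower (e : AddChar K Kˣ) (τ : Fin α → LaurentRing K n α)
    (ev : (Fin n → K) → LaurentRing K n α →ₐ[K] K) : Prop where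
  le : n ≤ α
  mem_lower_zero : ∀ i : Fin α, (i : ℕ) < n → τ i ∈ lower K n α 0
  mem_lower : ∀ i : Fin α, τ i ∈ lower K n α i
  indep : ∀ m : Fin α → ℤ, m ≠ 0 → ∀ b : K, ∑ i, (m i : LaurentRing K n α) * τ i ≠ algebraMap K _ b
  exists_x_eq : ∃ N : K, ∀ j : Fin n, x j = algebraMap K _ N * τ (Fin.castLE le j)
  ev_x : ∀ a j, ev a (x j) = a j
  ev_v : ∀ a i, ev a (v i) = (e (ev a (τ i)) : K)

variable {e : AddChar K Kˣ} {τ : Fin α → LaurentRing K n α}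
  {ev : (Fin n → K) → LaurentRing K n α →ₐ[K] K}

theorem ev_vMonomial (hT : IsExpTower e τ ev) (a : Fin n → K) (m : Fin α → ℤ) :
    ev a (vMonomial K n m) = (e (ev a (∑ i, (m i : LaurentRing K n α) * τ i)) : K) := by
  have h1 : ∀ s : Finset (Fin α), ((e (∑ i ∈ s, (m i : K) * ev a (τ i)) : Kˣ) : K) =
      ∏ i ∈ s, (e (ev a (τ i)) : K) ^ m i := by
    intro s
    induction s using Finset.cons_induction with
    | empty => simp
    | cons i s hi ih =>
      rw [Finset.sum_cons, Finset.prod_cons, AddChar.map_add_eq_mul, Units.val_mul, ih,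
        ← zsmul_eq_mul, AddChar.map_zsmul_eq_zpow, Units.val_zpow_eq_zpow_val]
  rw [map_vMonomial_field, map_sum]
  simp_rw [map_mul, map_intCast]
  rw [h1]
  exact Finset.prod_congr rfl fun i _ => by rw [hT.ev_v]

theorem mem_lower_of_lt_max (hT : IsExpTower e τ ev) {k : ℕ} {i : Fin α}
    (hi : (i : ℕ) < max (k + 1) n) : τ i ∈ lower K n α k := by
  rcases lt_max_iff.mp hi with h | h
  · exact lower_mono (Nat.lt_succ_iff.mp h) (hT.mem_lower i)
  · exact lower_mono (Nat.zero_le k) (hT.mem_lower_zero i h)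

/-- Every prime in the variables `xⱼ`, and `vᵢ` with `i < k`, that does not divide any `vᵢ` vanishes
at some exponential point. -/
def PrimesHaveZeros (k : ℕ) (ev : (Fin n → K) → LaurentRing K n α →ₐ[K] K) : Prop :=
  ∀ P : MvPolynomial (Fin n ⊕ Fin α) K, Prime P → (∀ i : Fin α, ¬ P ∣ X (Sum.inr i)) →
    P ∈ supported K (lowVars n α k) → ∃ a, ev a (ofPoly P) = 0

theorem PrimesHaveZeros.exists_zero {k : ℕ} (hk : PrimesHaveZeros k ev)
    {f : MvPolynomial (Fin n ⊕ Fin α) K} (hf0 : f ≠ 0) (hf : f ∈ supported K (lowVars n α k))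
    (hfm : ∀ d : Fin n ⊕ Fin α →₀ ℕ, ∀ c, IsLowExponent α d → f ≠ monomial d c) :
    ∃ a, ev a (ofPoly f) = 0 := by
  rcases exists_prime_dvd_or_eq_monomial hf0 with ⟨P, hP, hPf, hPv⟩ | ⟨d, hd, c, rfl⟩
  · obtain ⟨a, ha⟩ := hk P hP hPv (mem_supported.mpr fun s hs =>
      mem_supported.mp hf (vars_subset_vars_of_dvd hPf hf0 hs))
    obtain ⟨q, rfl⟩ := hPf
    exact ⟨a, by rw [map_mul, map_mul, ha, zero_mul]⟩
  · exact absurd rfl (hfm d c hd)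

/-- A nonconstant function takes the value `β` up to an element of the kernel of `exp`: of
`σ - β` and `σ - β - κ` at most one is a unit. -/
theorem PrimesHaveZeros.exists_exp_eq {k : ℕ} (hk : PrimesHaveZeros k ev)
    {κ : K} (hκ : e κ = 1) (hκ0 : κ ≠ 0) {σ : LaurentRing K n α} (hσ : σ ∈ lower K n α k)
    (hσ0 : ∀ b : K, σ ≠ algebraMap K _ b) (β : K) : ∃ a, e (ev a σ) = e β := by
  obtain ⟨p, hp, d, hd, hpd⟩ := exists_mul_monomial_eq hσ
  have hdu := isUnit_ofPoly_monomial (K := K) hd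
  have hC : ∀ c : K, monomial d c = C c * monomial d 1 := fun c => by
    rw [C_mul_monomial, mul_one]
  have hof : ∀ c : K, ofPoly (p - monomial d c) =
      (σ - algebraMap K _ c) * ofPoly (monomial d 1) := by
    intro c
    rw [hC, map_sub, map_mul, hpd, sub_mul]
    rfl
  have hnm : ∀ c c' : K, p - monomial d c ≠ monomial d c' := by
    intro c c' h
    rw [sub_eq_iff_eq_add, ← map_add, hC] at h
    rw [h, map_mul] at hpd
    exact hσ0 (c' + c) (hdu.mul_right_cancel hpd.symm)
  have key : ∀ c, (∀ d' : Fin n ⊕ Fin α →₀ ℕ, ∀ c', IsLowExponent α d' →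
      p - monomial d c ≠ monomial d' c') → ∃ a, ev a σ = c := by
    intro c hc
    obtain ⟨a, ha⟩ := hk.exists_zero (f := p - monomial d c)
      (fun h0 => hnm c 0 (by rw [h0, map_zero]))
      (sub_mem hp (monomial_mem_supported hd c)) hc
    refine ⟨a, ?_⟩
    rw [hof, map_mul] at ha
    have h1 := (mul_eq_zero.mp ha).resolve_right (hdu.map (ev a)).ne_zero
    rw [map_sub, AlgHom.commutes, sub_eq_zero] at h1
    exact h1
  by_cases h1 : ∃ d' : Fin n ⊕ Fin α →₀ ℕ, ∃ c', IsLowExponent α d' ∧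
      p - monomial d β = monomial d' c'
  · obtain ⟨d₁, c₁, _, h1⟩ := h1
    obtain ⟨a, ha⟩ := key (β + κ) (by
      intro d₂ c₂ _ h2
      have hd1 : d₁ ≠ d := by
        rintro rfl
        exact hnm _ _ h1
      have hd2 : d₂ ≠ d := by
        rintro rfl
        exact hnm _ _ h2
      have h3 := congrArg (coeff d) h1
      have h4 := congrArg (coeff d) h2
      rw [coeff_sub, coeff_monomial, coeff_monomial, if_pos rfl, if_neg hd1] at h3
      rw [coeff_sub, coeff_monomial, coeff_monomial, if_pos rfl, if_neg hd2] at h4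
      exact hκ0 (by linear_combination h3 - h4))
    exact ⟨a, by rw [ha, AddChar.map_add_eq_mul, hκ, mul_one]⟩
  · push Not at h1
    obtain ⟨a, ha⟩ := key β h1
    exact ⟨a, by rw [ha]⟩

theorem primesHaveZeros_zero [IsAlgClosed K] (hT : IsExpTower e τ ev) :
    PrimesHaveZeros 0 ev := by
  intro P hP _ hPs
  have hprime : (Ideal.span {P}).IsPrime := (Ideal.span_singleton_prime hP.ne_zero).mpr hP
  obtain ⟨φ⟩ := nonempty_algHom_of_finiteType K
    (MvPolynomial (Fin n ⊕ Fin α) K ⧸ Ideal.span {P})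
  let ψ := φ.comp (Ideal.Quotient.mkₐ K (Ideal.span {P}))
  have hψ : ψ P = 0 := by
    have h1 : Ideal.Quotient.mkₐ K (Ideal.span {P}) P = 0 :=
      Ideal.Quotient.eq_zero_iff_mem.mpr (Ideal.mem_span_singleton_self _)
    simp [ψ, -Ideal.Quotient.mkₐ_eq_mk, h1]
  refine ⟨fun j => ψ (X (Sum.inl j)), ?_⟩
  rw [← hψ]
  refine eqOn_supported (f := (ev _).comp ofPoly) (g := ψ) ?_ hPs
  rintro (j | i) hs
  · exact hT.ev_x _ j
  · exact absurd (inr_mem_lowVars.mp hs) (Nat.not_lt_zero _)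

theorem prod_extend_castLE {F : Type*} [Field F] {l : ℕ} (hl : l ≤ α) (m : Fin l → ℤ)
    (g : Fin α → F) :
    ∏ i, g i ^ (Function.extend (Fin.castLE hl) m 0 i) = ∏ i, g (Fin.castLE hl i) ^ m i := by
  refine (Fintype.prod_of_injective _ (Fin.castLE_injective hl) _ _ ?_ ?_).symm
  · intro i hi
    rw [Function.extend_apply' _ _ _ hi]
    simp
  · intro i
    rw [(Fin.castLE_injective hl).extend_apply]

theorem sum_extend_castLE {R : Type*} [CommRing R] {l : ℕ} (hl : l ≤ α) (m : Fin l → ℤ)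
    (g : Fin α → R) :
    ∑ i, ((Function.extend (Fin.castLE hl) m 0 i : ℤ) : R) * g i =
      ∑ i, (m i : R) * g (Fin.castLE hl i) := by
  refine (Fintype.sum_of_injective _ (Fin.castLE_injective hl) _ _ ?_ ?_).symm
  · intro i hi
    rw [Function.extend_apply' _ _ _ hi]
    simp
  · intro i
    rw [(Fin.castLE_injective hl).extend_apply]

theorem extend_castLE_ne_zero {l : ℕ} (hl : l ≤ α) {m : Fin l → ℤ} (hm : m ≠ 0) :
    Function.extend (Fin.castLE hl) m 0 ≠ 0 := by
  intro h
  refine hm (funext fun i => ?_)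
  have := congrFun h (Fin.castLE hl i)
  rwa [(Fin.castLE_injective hl).extend_apply] at this

variable {F : Type u} [Field F] [Algebra K F]

theorem map_mem_acl_of_mem_lower (χ : LaurentRing K n α →ₐ[K] F) {k : ℕ} {g : LaurentRing K n α}
    (hg : g ∈ lower K n α k) {s : Set F} (hx : ∀ j, χ (x j) ∈ s)
    (hv : ∀ i : Fin α, (i : ℕ) < k → χ (v i) ∈ s) : χ g ∈ acl K s := by
  have hle : lower K n α k ≤ (acl K s).toSubalgebra.comap χ := by
    refine Algebra.adjoin_le ?_
    rintro _ (⟨j, rfl⟩ | ⟨i, hi, rfl | rfl⟩)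
    · exact subset_acl s (hx j)
    · exact subset_acl s (hv i hi)
    · change χ _ ∈ acl K s
      have h1 : χ ((vUnit i)⁻¹ : (LaurentRing K n α)ˣ) = (χ (v i))⁻¹ := by
        refine eq_inv_of_mul_eq_one_left ?_
        rw [← map_mul, ← coe_vUnit, Units.inv_mul, map_one]
      rw [h1]
      exact inv_mem (subset_acl s (hv i hi))
  exact hle hg

/-- A point `(a, exp a)` at which the polynomial relations of the generic point hold is of the form
`(τ(ξ), exp τ(ξ))` for some `ξ`, and functions vanishing at the generic point vanish at `ξ`. -/
theorem exists_ev_eq_zero_of_specialization (hT : IsExpTower e τ ev) {l : ℕ} (hl : l ≤ α)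
    (hnl : n ≤ l) (χ : LaurentRing K n α →ₐ[K] F) (a : Fin l → K)
    (ha : ∀ f : MvPolynomial (Fin l ⊕ Fin l) K,
      aeval (Sum.elim (fun i => χ (τ (Fin.castLE hl i))) (fun i => χ (v (Fin.castLE hl i)))) f = 0 →
      MvPolynomial.eval (Sum.elim a (fun i => (e (a i) : K))) f = 0) :
    ∃ ξ, ∀ f ∈ supported K (lowVars n α l), χ (ofPoly f) = 0 → ev ξ (ofPoly f) = 0 := by
  obtain ⟨N, hN⟩ := hT.exists_x_eq
  let θ : MvPolynomial (Fin n ⊕ Fin α) K →ₐ[K] MvPolynomial (Fin l ⊕ Fin l) K :=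
    aeval (Sum.elim (fun j => C N * X (Sum.inl (Fin.castLE hnl j)))
      (fun i => if h : (i : ℕ) < l then X (Sum.inr ⟨i, h⟩) else 0))
  let ξ : Fin n → K := fun j => N * a (Fin.castLE hnl j)
  have hθχ : ∀ f ∈ supported K (lowVars n α l),
      aeval (Sum.elim (fun i => χ (τ (Fin.castLE hl i))) (fun i => χ (v (Fin.castLE hl i)))) (θ f) =
        χ (ofPoly f) := by
    intro f hf
    refine eqOn_supported (f := (aeval _).comp θ) (g := χ.comp ofPoly) ?_ hf
    rintro (j | i) hs
    · simp only [AlgHom.comp_apply, θ, aeval_X, Sum.elim_inl, map_mul]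
      change _ = χ (x j)
      rw [hN j, map_mul, AlgHom.commutes, aeval_C]
      rfl
    · have hi := inr_mem_lowVars.mp hs
      simp only [AlgHom.comp_apply, θ, aeval_X, Sum.elim_inr, dif_pos hi]
      rfl
  have hθev : ∀ k ≤ l, (∀ i : Fin l, (i : ℕ) < k → ev ξ (v (Fin.castLE hl i)) = (e (a i) : K)) →
      ∀ f ∈ supported K (lowVars n α k),
        MvPolynomial.eval (Sum.elim a (fun i => (e (a i) : K))) (θ f) = ev ξ (ofPoly f) := by
    intro k hk hind f hf
    refine eqOn_supported
      (f := (aeval (R := K) (Sum.elim a (fun i => (e (a i) : K)))).comp θ)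
      (g := (ev ξ).comp ofPoly) ?_ hf
    rintro (j | i) hs
    · simp only [AlgHom.comp_apply, θ, aeval_X, Sum.elim_inl, map_mul]
      change _ = ev ξ (x j)
      rw [hT.ev_x, aeval_C]
      rfl
    · have hi := inr_mem_lowVars.mp hs
      simp only [AlgHom.comp_apply, θ, aeval_X, Sum.elim_inr, dif_pos (hi.trans_le hk)]
      exact (hind ⟨i, hi.trans_le hk⟩ hi).symm
  have hind : ∀ k : ℕ, ∀ i : Fin l, (i : ℕ) < k → ev ξ (v (Fin.castLE hl i)) = (e (a i) : K) := by
    intro k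
    induction k with
    | zero => exact fun i hi => absurd hi (Nat.not_lt_zero _)
    | succ k ih =>
      intro i hi
      rcases Nat.lt_succ_iff_lt_or_eq.mp hi with h | h
      · exact ih i h
      have hkl : k ≤ l := h ▸ i.2.le
      obtain ⟨p, hp, d, hd, hpd⟩ := exists_mul_monomial_eq (hT.mem_lower (Fin.castLE hl i))
      have hik : ((Fin.castLE hl i : Fin α) : ℕ) = k := h
      rw [hik] at hp hd
      have hds := monomial_mem_supported hd (1 : K)
      -- The relation expressing `τ i` through the lower variables specialises.
      have hrel := ha (X (Sum.inl i) * θ (monomial d 1) - θ p) (by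
        rw [map_sub, map_mul, hθχ _ (supported_mono (lowVars_mono hkl) hds),
          hθχ _ (supported_mono (lowVars_mono hkl) hp), hpd, map_mul, aeval_X, Sum.elim_inl,
          sub_self])
      rw [map_sub, map_mul, hθev k hkl ih _ hds, hθev k hkl ih _ hp, hpd, map_mul, eval_X,
        Sum.elim_inl, sub_eq_zero] at hrel
      rw [hT.ev_v, mul_right_cancel₀ ((isUnit_ofPoly_monomial hd).map (ev ξ)).ne_zero hrel]
  refine ⟨ξ, fun f hf hχ => ?_⟩
  rw [← hθev l le_rfl (hind l) f hf]
  exact ha _ (by rw [hθχ f hf, hχ])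

/-- The induction step: the generic point of a hypersurface that involves `v_k` is free and rotund,
unless zeros are provided by polynomials in the lower variables. -/
theorem primesHaveZeros_succ [CharZero K] [IsAlgClosed K] (hEC : ExistentialClosedness e)
    (hsurj : Function.Surjective e) {κ : K} (hκ : e κ = 1) (hκ0 : κ ≠ 0)
    (hT : IsExpTower e τ ev) {k : ℕ} (hk : k < α) (ih : PrimesHaveZeros k ev) :
    PrimesHaveZeros (k + 1) ev := by
  intro P hP hPv hPs
  by_cases hPk : P ∈ supported K (lowVars n α k)
  · exact ih P hP hPv hPk
  have hz : Sum.inr ⟨k, hk⟩ ∈ P.vars := by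
    rw [mem_supported, Set.not_subset] at hPk
    obtain ⟨s, hs, hsk⟩ := hPk
    have hs' := mem_supported.mp hPs hs
    rcases s with j | i
    · exact absurd (inl_mem_lowVars k j) hsk
    · have h1 := inr_mem_lowVars.mp hs'
      have h2 := mt inr_mem_lowVars.mpr hsk
      have h3 : i = ⟨k, hk⟩ := Fin.ext (by simp only; omega)
      exact h3 ▸ hs
  obtain ⟨F, _, _, χ, hχ⟩ := exists_algHom_field_of_prime hP hPv
  have hl : max (k + 1) n ≤ α := max_le hk hT.le
  set l := max (k + 1) n with hldef
  have hkl : k < l := lt_max_of_lt_left (Nat.lt_succ_self k)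
  let u' : Fin l → F := fun i => χ (τ (Fin.castLE hl i))
  let v' : Fin l → F := fun i => χ (v (Fin.castLE hl i))
  have hv' : ∀ i, v' i ≠ 0 := fun i => fun h0 => hPv _ ((hχ _).mp h0)
  have hσ : ∀ m : Fin l → ℤ,
      ∑ i, (m i : LaurentRing K n α) * τ (Fin.castLE hl i) ∈ lower K n α k := fun m =>
    sum_mem fun i _ => mul_mem (intCast_mem _ _) (mem_lower_of_lt_max hT i.2)
  have hσ0 : ∀ m : Fin l → ℤ, m ≠ 0 → ∀ b : K,
      ∑ i, (m i : LaurentRing K n α) * τ (Fin.castLE hl i) ≠ algebraMap K _ b := by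
    intro m hm b
    rw [← sum_extend_castLE hl m τ]
    exact hT.indep _ (extend_castLE_ne_zero hl hm) b
  -- An additive relation would be divisible by `P`, but does not involve `v_k`.
  have hadd : ∀ m : Fin l → ℤ, m ≠ 0 → ∀ b : K, ∑ i, (m i : F) * u' i ≠ algebraMap K F b := by
    intro m hm b hb
    have hmem := sub_mem (hσ m) (Subalgebra.algebraMap_mem (lower K n α k) b)
    obtain ⟨p, hp, d, hd, hpd⟩ := exists_mul_monomial_eq hmem
    have hp0 : p ≠ 0 := by
      rintro rfl
      rw [map_zero, eq_comm] at hpd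
      have h1 := (mul_eq_zero.mp hpd).resolve_right (isUnit_ofPoly_monomial hd).ne_zero
      exact hσ0 m hm b (sub_eq_zero.mp h1)
    have hPp : P ∣ p := by
      rw [← hχ, hpd, map_mul, map_sub, map_sum, AlgHom.commutes, ← hb]
      simp [u']
    exact hPk (mem_supported.mpr fun s hs =>
      mem_supported.mp hp (vars_subset_vars_of_dvd hPp hp0 hs))
  by_cases hmul : ∀ m : Fin l → ℤ, m ≠ 0 → ∀ b : K, ∏ i, v' i ^ m i ≠ algebraMap K F b
  · obtain ⟨a, ha⟩ := hEC.exists_specialization (by omega : 1 ≤ l) u' hv' hadd hmul (by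
      intro r C hr hC
      refine le_eRk_range_matrix (fun j => χ (x j)) u' hv' hadd ?_ ?_ C hr hC
      · intro i
        refine map_mem_acl_of_mem_lower χ (hT.mem_lower _) (fun j => Or.inl ⟨j, rfl⟩) ?_
        intro j hj
        exact Or.inr ⟨⟨j, hj.trans i.2⟩, hj, rfl⟩
      · have hind := algebraicIndependent_of_mem_vars (q := χ.comp ofPoly)
          (fun f => (hχ f).mp) hz
        let ι := {y : Fin n ⊕ Fin l // y ≠ Sum.inr ⟨k, hkl⟩}
        let g : ι → {y : Fin n ⊕ Fin α // y ≠ Sum.inr ⟨k, hk⟩} := fun y =>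
          ⟨Sum.map id (Fin.castLE hl) y.1, by
            rcases y with ⟨j | i, hy⟩
            · simp
            · intro h
              refine hy (congrArg Sum.inr (Fin.ext ?_))
              have h2 := Sum.inr.inj h
              simpa [Fin.ext_iff] using h2⟩
        have hg : Function.Injective g := by
          intro y y' h
          exact Subtype.ext ((Function.injective_id.sumMap (Fin.castLE_injective hl))
            (congrArg Subtype.val h))
        have hind' := (hind.comp g hg).coe_range
        have hcard := (AlgebraicIndependent.matroid_indep_iff.mpr hind').eRk_eq_encard
        have hinj := (hind.comp g hg).injective
        rw [← Set.image_univ, hinj.encard_image, Set.encard_univ, ENat.card_eq_coe_fintype_card,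
          Fintype.card_subtype_compl, Fintype.card_sum, Fintype.card_fin, Fintype.card_fin,
          Fintype.card_subtype_eq] at hcard
        have hsub : ((fun y : {y : Fin n ⊕ Fin α // y ≠ Sum.inr ⟨k, hk⟩} =>
            (χ.comp ofPoly) (X y.1)) ∘ g) '' Set.univ ⊆
            Set.range (fun j => χ (x j)) ∪ Set.range v' := by
          rintro _ ⟨⟨j | i, hy⟩, _, rfl⟩
          · exact Or.inl ⟨j, rfl⟩
          · exact Or.inr ⟨i, rfl⟩
        refine le_trans ?_ (add_le_add_left ((AlgebraicIndependent.matroid K F).eRk_mono hsub) 1)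
        rw [hcard]
        norm_cast
        omega)
    obtain ⟨ξ, hξ⟩ := exists_ev_eq_zero_of_specialization hT hl (le_max_right _ _) χ a ha
    exact ⟨ξ, hξ P (supported_mono (lowVars_mono (le_max_left _ _)) hPs) ((hχ P).mpr dvd_rfl)⟩
  · push Not at hmul
    obtain ⟨m, hm, b, hb⟩ := hmul
    obtain ⟨m', hm'0, hm'm, b', hφ⟩ := exists_vMonomial_of_map_eq χ hχ
      (extend_castLE_ne_zero hl hm) (b := b) (by
        rw [map_vMonomial_field, prod_extend_castLE hl m (fun i => χ (v i))]
        exact hb)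
    have hmem : ∑ i, (m' i : LaurentRing K n α) * τ i ∈ lower K n α k := by
      refine sum_mem fun i _ => ?_
      by_cases hi : (i : ℕ) < l
      · exact mul_mem (intCast_mem _ _) (mem_lower_of_lt_max hT hi)
      · rw [hm'm i, Int.cast_zero, zero_mul]
        · exact zero_mem _
        · refine Function.extend_apply' _ _ _ ?_
          rintro ⟨j, rfl⟩
          exact hi j.2
    obtain ⟨β, hβ⟩ := hsurj b'
    obtain ⟨a, ha⟩ := ih.exists_exp_eq hκ hκ0 hmem (hT.indep m' hm'0) β
    exact ⟨a, hφ _ (by rw [ev_vMonomial hT, ha, hβ])⟩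

theorem IsExpTower.exists_zero [CharZero K] [IsAlgClosed K] (hEC : ExistentialClosedness e)
    (hsurj : Function.Surjective e) {κ : K} (hκ : e κ = 1) (hκ0 : κ ≠ 0)
    (hT : IsExpTower e τ ev) {f : MvPolynomial (Fin n ⊕ Fin α) K} (hf0 : f ≠ 0)
    (hfm : ∀ d : Fin n ⊕ Fin α →₀ ℕ, ∀ c, IsLowExponent α d → f ≠ monomial d c) :
    ∃ a, ev a (ofPoly f) = 0 := by
  have h : ∀ k ≤ α, PrimesHaveZeros k ev := by
    intro k
    induction k with
    | zero => exact fun _ => primesHaveZeros_zero hT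
    | succ k ih => exact fun hk => primesHaveZeros_succ hEC hsurj hκ hκ0 hT hk (ih (by omega))
  refine (h α le_rfl).exists_zero hf0 (mem_supported.mpr fun s _ => ?_) hfm
  rcases s with j | i
  · exact inl_mem_lowVars _ j
  · exact inr_mem_lowVars.mpr i.2

end Tower

/-! ### Exponential polynomials as elements of towers -/

section ExpSequence

open ExpPoly

variable {K : Type u} [Field K] [CharZero K] {e : AddChar K Kˣ} {n : ℕ}

instance ExpPoly.instAlgebra : Algebra K (ExpPoly e n) :=
  ((ExpPoly.of e n 0).comp (MvPolynomial.C : K →+* MvPolynomial (Fin n) K)).toAlgebra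

theorem ExpPoly.algebraMap_eq_C (c : K) : algebraMap K (ExpPoly e n) c = C c := rfl

/-- Evaluation as a `K`-algebra homomorphism. -/
def ExpPoly.evalAlgHom (a : Fin n → K) : ExpPoly e n →ₐ[K] K where
  __ := eval a
  commutes' c := eval_C a c

/-- The subalgebra generated by the variables and the exponentials of `± t i` for `i < k`. -/
def expSubalgebra (t : ℕ → ExpPoly e n) (k : ℕ) : Subalgebra K (ExpPoly e n) :=
  Algebra.adjoin K (Set.range X ∪ {g | ∃ i < k, g = exp (t i) ∨ g = exp (-t i)})

theorem X_mem_expSubalgebra (t : ℕ → ExpPoly e n) (k : ℕ) (j : Fin n) :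
    X j ∈ expSubalgebra t k :=
  Algebra.subset_adjoin (Or.inl ⟨j, rfl⟩)

theorem exp_zsmul_mem_expSubalgebra (t : ℕ → ExpPoly e n) {k i : ℕ} (hi : i < k) (m : ℤ) :
    (exp (m • t i) : ExpPoly e n) ∈ expSubalgebra t k := by
  have h1 : (exp (t i) : ExpPoly e n) ∈ expSubalgebra t k :=
    Algebra.subset_adjoin (Or.inr ⟨i, hi, Or.inl rfl⟩)
  have h2 : (exp (-t i) : ExpPoly e n) ∈ expSubalgebra t k :=
    Algebra.subset_adjoin (Or.inr ⟨i, hi, Or.inr rfl⟩)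
  cases m with
  | ofNat N =>
    rw [Int.ofNat_eq_natCast, natCast_zsmul, AddChar.map_nsmul_eq_pow, Units.val_pow_eq_pow_val]
    exact pow_mem h1 N
  | negSucc N =>
    rw [negSucc_zsmul, ← smul_neg, AddChar.map_nsmul_eq_pow, Units.val_pow_eq_pow_val]
    exact pow_mem h2 _

theorem expSubalgebra_le {t t' : ℕ → ExpPoly e n} {k k' : ℕ}
    (h : ∀ i < k, ∃ i' < k', ∃ m : ℤ, t i = m • t' i') :
    expSubalgebra t k ≤ expSubalgebra t' k' := by
  refine Algebra.adjoin_le ?_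
  rintro _ (⟨j, rfl⟩ | ⟨i, hi, hg⟩)
  · exact X_mem_expSubalgebra t' k' j
  · obtain ⟨i', hi', m, hm⟩ := h i hi
    rcases hg with rfl | rfl
    · rw [hm]
      exact exp_zsmul_mem_expSubalgebra t' hi' m
    · rw [hm, ← neg_smul]
      exact exp_zsmul_mem_expSubalgebra t' hi' (-m)

/-- A sequence of exponents `t₀, …, t_{k-1}` that are linearly independent over `ℤ` modulo
constants, each of which is a polynomial in the variables and the exponentials of the preceding
ones; the first `n` are proportional to the variables. -/
structure IsExpSequence (t : ℕ → ExpPoly e n) (k : ℕ) : Prop where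
  le : n ≤ k
  mem : ∀ i < k, t i ∈ expSubalgebra t i
  indep : ∀ m : Fin k → ℤ, m ≠ 0 → ∀ b : K, ∑ i, m i • t i ≠ C b
  exists_eq_X : ∃ N : K, N ≠ 0 ∧ ∀ j : Fin n, t j = N • X j

theorem exists_isExpSequence : ∃ t : ℕ → ExpPoly e n, IsExpSequence t n := by
  let t : ℕ → ExpPoly e n := fun i => if h : i < n then X ⟨i, h⟩ else 0
  have ht : ∀ j : Fin n, t j = X j := fun j => by simp [t]
  refine ⟨t, le_rfl, fun i hi => ?_, fun m hm b hb => ?_, 1, one_ne_zero, fun j => ?_⟩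
  · simp only [t, dif_pos hi]
    exact X_mem_expSubalgebra _ _ _
  · have h1 : ∀ a : Fin n → K, ∑ i, (m i : K) * a i = b := by
      intro a
      have := congrArg (eval a) hb
      rw [eval_C, map_sum] at this
      rw [← this]
      refine Finset.sum_congr rfl fun i _ => ?_
      rw [map_zsmul, ht, eval_X, zsmul_eq_mul]
    have hb0 : b = 0 := by
      rw [← h1 0]
      simp
    refine hm (funext fun i => ?_)
    have := h1 (Pi.single i 1)
    simpa [Pi.single_apply, hb0] using this
  · rw [ht, one_smul]

/-- The ring of an exponential sequence can be enlarged to contain the exponential of any of its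
elements: either the element extends the sequence, or it is a rational combination of it modulo
constants, and the sequence is divided by the common denominator. -/
theorem IsExpSequence.exists_exp_mem {t : ℕ → ExpPoly e n} {k : ℕ} (ht : IsExpSequence t k)
    {b : ExpPoly e n} (hb : b ∈ expSubalgebra t k) :
    ∃ t' k', IsExpSequence (e := e) t' k' ∧ expSubalgebra t k ≤ expSubalgebra t' k' ∧
      (exp b : ExpPoly e n) ∈ expSubalgebra t' k' := by
  by_cases hdep : ∃ M : ℤ, M ≠ 0 ∧ ∃ m : Fin k → ℤ, ∃ c : K, M • b + ∑ i, m i • t i = C c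
  · obtain ⟨M, hM, m, c, hc⟩ := hdep
    have hMK : (M : K) ≠ 0 := Int.cast_ne_zero.mpr hM
    let t' : ℕ → ExpPoly e n := fun i => (M : K)⁻¹ • t i
    have htt' : ∀ i, t i = M • t' i := by
      intro i
      simp only [t']
      rw [← Int.cast_smul_eq_zsmul K, smul_inv_smul₀ hMK]
    have hle : ∀ l, expSubalgebra t l ≤ expSubalgebra t' l := fun l =>
      expSubalgebra_le fun i hi => ⟨i, hi, M, htt' i⟩
    refine ⟨t', k, ⟨ht.le, fun i hi => ?_, fun m hm b hb => ?_, ?_⟩, hle k, ?_⟩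
    · exact Subalgebra.smul_mem _ (hle i (ht.mem i hi)) _
    · refine ht.indep m hm (M * b) ?_
      rw [← algebraMap_eq_C, map_mul, algebraMap_eq_C b, ← hb, Finset.mul_sum]
      refine Finset.sum_congr rfl fun i _ => ?_
      rw [htt', smul_comm, ← Algebra.smul_def, Int.cast_smul_eq_zsmul]
    · obtain ⟨N, hN, h⟩ := ht.exists_eq_X
      refine ⟨(M : K)⁻¹ * N, mul_ne_zero (inv_ne_zero hMK) hN, fun j => ?_⟩
      simp only [t']
      rw [h, mul_smul]
    · have hbt : b = C ((M : K)⁻¹ * c) + ∑ i, (-m i) • t' i := by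
        have h1 : (M : K)⁻¹ • (M • b + ∑ i, m i • t i) = (M : K)⁻¹ • C c := by rw [hc]
        rw [smul_add, ← Int.cast_smul_eq_zsmul K, inv_smul_smul₀ hMK, Finset.smul_sum,
          Algebra.smul_def, ← algebraMap_eq_C c, ← map_mul, algebraMap_eq_C] at h1
        rw [← h1, add_assoc, ← Finset.sum_add_distrib, Finset.sum_eq_zero, add_zero]
        intro i _
        simp only [t']
        rw [smul_comm, neg_smul, add_neg_cancel]
      have hsum : ∀ s : Finset (Fin k), (exp (∑ i ∈ s, (-m i) • t' i) : ExpPoly e n) ∈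
          expSubalgebra t' k := by
        intro s
        induction s using Finset.cons_induction with
        | empty => simp
        | cons i s hi ih =>
          rw [Finset.sum_cons, AddChar.map_add_eq_mul, Units.val_mul]
          exact mul_mem (exp_zsmul_mem_expSubalgebra t' i.2 _) ih
      rw [hbt, AddChar.map_add_eq_mul, Units.val_mul, exp_C, ← algebraMap_eq_C]
      exact mul_mem (Subalgebra.algebraMap_mem _ _) (hsum _)
  · push Not at hdep
    let t' : ℕ → ExpPoly e n := Function.update t k b
    have ht' : ∀ i < k, t' i = t i := fun i hi => Function.update_of_ne hi.ne _ _
    have htk : t' k = b := Function.update_self _ _ _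
    have hle : ∀ l ≤ k, ∀ l', l ≤ l' → expSubalgebra t l ≤ expSubalgebra t' l' :=
      fun l hl l' hl' => expSubalgebra_le fun i hi =>
        ⟨i, hi.trans_le hl', 1, by rw [ht' i (hi.trans_le hl), one_smul]⟩
    refine ⟨t', k + 1, ⟨ht.le.trans (Nat.le_succ k), fun i hi => ?_, fun m hm c hc => ?_, ?_⟩,
      hle k le_rfl _ (Nat.le_succ k), ?_⟩
    · rcases Nat.lt_succ_iff_lt_or_eq.mp hi with h | rfl
      · rw [ht' i h]
        exact hle i h.le i le_rfl (ht.mem i h)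
      · rw [htk]
        exact hle i le_rfl i le_rfl hb
    · rw [Fin.sum_univ_castSucc] at hc
      simp only [Fin.val_castSucc, Fin.val_last, htk] at hc
      have h1 : ∀ i : Fin k, m i.castSucc • t' i = m i.castSucc • t i := fun i => by
        rw [ht' i i.2]
      simp_rw [h1] at hc
      have h2 : m (Fin.last k) = 0 := by
        by_contra h0
        exact hdep _ h0 (fun i => m i.castSucc) c (by rw [add_comm]; exact hc)
      rw [h2, zero_smul, add_zero] at hc
      refine ht.indep (fun i => m i.castSucc) ?_ c hc
      intro h3
      refine hm (funext fun i => ?_)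
      induction i using Fin.lastCases with
      | last => exact h2
      | cast i => exact congrFun h3 i
    · obtain ⟨N, hN, h⟩ := ht.exists_eq_X
      exact ⟨N, hN, fun j => by rw [ht' j (j.2.trans_le ht.le), h]⟩
    · have h1 := exp_zsmul_mem_expSubalgebra t' (Nat.lt_succ_self k) 1
      rwa [one_smul, htk] at h1

theorem of_single (i : ℕ) (b : (expChain e n i).compl) (r : (expChain e n i).carrier) :
    of e n (i + 1) (AddMonoidAlgebra.single b r : (expChain e n i).ExtCarrier) =
      of e n i r * exp (of e n i b) := by
  rw [exp_of, ← of_step e n i r, ← map_mul]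
  congr 1
  change (AddMonoidAlgebra.single b r : (expChain e n i).ExtCarrier) =
    (expChain e n i).incl r * ((expChain e n i).expExt b : (expChain e n i).ExtCarrier)
  have h1 : ((expChain e n i).expExt b : (expChain e n i).ExtCarrier) =
      AddMonoidAlgebra.single b 1 := by
    simp [PartialERing.expExt]
  rw [h1]
  simp [PartialERing.incl]

/-- Every exponential polynomial lies in the ring of some exponential sequence. -/
theorem IsExpSequence.exists_mem {t : ℕ → ExpPoly e n} {k : ℕ} (ht : IsExpSequence t k)
    (p : ExpPoly e n) :
    ∃ t' k', IsExpSequence (e := e) t' k' ∧ expSubalgebra t k ≤ expSubalgebra t' k' ∧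
      p ∈ expSubalgebra t' k' := by
  obtain ⟨i, y, rfl⟩ : ∃ i y, p = of e n i y := DirectLimit.exists_eq_mk _ p
  induction i generalizing t k with
  | zero =>
    refine ⟨t, k, ht, le_rfl, ?_⟩
    change MvPolynomial (Fin n) K at y
    induction y using MvPolynomial.induction_on with
    | C c => exact Subalgebra.algebraMap_mem _ c
    | add y z hy hz =>
      have : of e n 0 (y + z : MvPolynomial (Fin n) K) = of e n 0 y + of e n 0 z :=
        map_add (of e n 0) y z
      rw [this]
      exact add_mem hy hz
    | mul_X y j hy =>
      have : of e n 0 (y * MvPolynomial.X j : MvPolynomial (Fin n) K) = of e n 0 y * X j :=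
        map_mul (of e n 0) y _
      rw [this]
      exact mul_mem hy (X_mem_expSubalgebra t k j)
  | succ i ih =>
    change (expChain e n i).ExtCarrier at y
    induction y using AddMonoidAlgebra.induction_linear generalizing t k with
    | zero => exact ⟨t, k, ht, le_rfl, (map_zero (of e n (i + 1))).symm ▸ zero_mem _⟩
    | add y z hy hz =>
      obtain ⟨t₁, k₁, ht₁, hle₁, hy₁⟩ := hy ht
      obtain ⟨t₂, k₂, ht₂, hle₂, hz₂⟩ := hz ht₁
      refine ⟨t₂, k₂, ht₂, hle₁.trans hle₂, ?_⟩
      have : of e n (i + 1) (y + z : (expChain e n i).ExtCarrier) =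
          of e n (i + 1) y + of e n (i + 1) z := map_add (of e n (i + 1)) y z
      rw [this]
      exact add_mem (hle₂ hy₁) hz₂
    | single b r =>
      obtain ⟨t₁, k₁, ht₁, hle₁, hr⟩ := ih ht r
      obtain ⟨t₂, k₂, ht₂, hle₂, hb⟩ := ih ht₁ (b : (expChain e n i).carrier)
      obtain ⟨t₃, k₃, ht₃, hle₃, hexp⟩ := ht₂.exists_exp_mem hb
      refine ⟨t₃, k₃, ht₃, (hle₁.trans hle₂).trans hle₃, ?_⟩
      rw [of_single]
      exact mul_mem (hle₃ (hle₂ hr)) hexp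

/-- The substitution `xⱼ ↦ Xⱼ`, `vᵢ ↦ exp (t i)`. -/
def expSubst (t : ℕ → ExpPoly e n) (k : ℕ) : LaurentRing K n k →ₐ[K] ExpPoly e n :=
  LaurentRing.lift X (fun i => exp (t i))

theorem exists_expSubst_eq (t : ℕ → ExpPoly e n) {k l : ℕ} (hl : l ≤ k) {p : ExpPoly e n}
    (hp : p ∈ expSubalgebra t l) : ∃ g ∈ LaurentRing.lower K n k l, expSubst t k g = p := by
  have hle : expSubalgebra t l ≤ (LaurentRing.lower K n k l).map (expSubst t k) := by
    refine Algebra.adjoin_le ?_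
    rintro _ (⟨j, rfl⟩ | ⟨i, hi, rfl | rfl⟩)
    · exact ⟨LaurentRing.x j, Algebra.subset_adjoin (Or.inl ⟨j, rfl⟩), LaurentRing.lift_x _ _ j⟩
    · exact ⟨LaurentRing.v ⟨i, hi.trans_le hl⟩,
        Algebra.subset_adjoin (Or.inr ⟨⟨i, hi.trans_le hl⟩, hi, Or.inl rfl⟩),
        LaurentRing.lift_v _ _ _⟩
    · refine ⟨((LaurentRing.vUnit ⟨i, hi.trans_le hl⟩)⁻¹ : (LaurentRing K n k)ˣ),
        Algebra.subset_adjoin (Or.inr ⟨⟨i, hi.trans_le hl⟩, hi, Or.inr rfl⟩), ?_⟩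
      have h1 : Units.map (expSubst t k : LaurentRing K n k →* ExpPoly e n)
          (LaurentRing.vUnit ⟨i, hi.trans_le hl⟩) = exp (t i) :=
        Units.ext (LaurentRing.lift_v _ _ _)
      have h2 := congrArg (fun w => ((w⁻¹ : (ExpPoly e n)ˣ) : ExpPoly e n)) h1
      simp only [← map_inv, ← AddChar.map_neg_eq_inv] at h2
      exact h2
  exact hle hp

theorem IsExpSequence.exists_isExpTower {t : ℕ → ExpPoly e n} {k : ℕ} (ht : IsExpSequence t k) :
    ∃ τ, IsExpTower (α := k) e τ (fun a => (evalAlgHom a).comp (expSubst t k)) := by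
  obtain ⟨N, hN, hX⟩ := ht.exists_eq_X
  have h1 : ∀ i : Fin k, ∃ g : LaurentRing K n k, expSubst t k g = t i ∧
      g ∈ LaurentRing.lower K n k i ∧ ∀ h : (i : ℕ) < n, g = N • LaurentRing.x ⟨i, h⟩ := by
    intro i
    by_cases hi : (i : ℕ) < n
    · refine ⟨N • LaurentRing.x ⟨i, hi⟩, ?_, ?_, fun _ => rfl⟩
      · rw [map_smul, hX ⟨i, hi⟩]
        exact congrArg (N • ·) (LaurentRing.lift_x _ _ _)
      · exact Subalgebra.smul_mem _ (LaurentRing.x_mem_lower _ _) _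
    · obtain ⟨g, hg, hgt⟩ := exists_expSubst_eq t i.2.le (ht.mem i i.2)
      exact ⟨g, hgt, hg, fun h => absurd h hi⟩
  choose τ hτt hτl hτx using h1
  refine ⟨τ, ht.le, fun i hi => ?_, hτl, fun m hm b hb => ?_, ⟨N⁻¹, fun j => ?_⟩, fun a j => ?_,
    fun a i => ?_⟩
  · rw [hτx i hi]
    exact Subalgebra.smul_mem _ (LaurentRing.x_mem_lower _ _) _
  · refine ht.indep m hm b ?_
    have h2 := congrArg (expSubst t k) hb
    rw [AlgHom.commutes, algebraMap_eq_C] at h2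
    rw [← h2, map_sum]
    refine Finset.sum_congr rfl fun i _ => ?_
    rw [map_mul, map_intCast, hτt, zsmul_eq_mul]
  · rw [hτx (Fin.castLE ht.le j) j.2, ← Algebra.smul_def, inv_smul_smul₀ hN]
    rfl
  · exact (congrArg (eval a) (LaurentRing.lift_x _ _ j)).trans (eval_X a j)
  · rw [AlgHom.comp_apply, AlgHom.comp_apply, hτt]
    exact (congrArg (eval a) (LaurentRing.lift_v _ _ i)).trans (eval_exp a (t i))

theorem exists_expSubst_monomial_eq_exp (t : ℕ → ExpPoly e n) {k : ℕ} {d : Fin n ⊕ Fin k →₀ ℕ}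
    (hd : LaurentRing.IsLowExponent k d) :
    ∃ g : ExpPoly e n, expSubst t k (LaurentRing.ofPoly (MvPolynomial.monomial d 1)) = exp g := by
  let S : Submonoid (ExpPoly e n) :=
    { carrier := {p | ∃ g : ExpPoly e n, p = exp g}
      one_mem' := ⟨0, by simp⟩
      mul_mem' := by
        rintro _ _ ⟨g, rfl⟩ ⟨g', rfl⟩
        exact ⟨g + g', by rw [AddChar.map_add_eq_mul, Units.val_mul]⟩ }
  have h1 : expSubst t k (LaurentRing.ofPoly (MvPolynomial.monomial d 1)) ∈ S := by
    rw [MvPolynomial.monomial_eq, Finsupp.prod, map_one, one_mul, map_prod, map_prod]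
    refine prod_mem fun s hs => ?_
    obtain ⟨i, rfl, _⟩ := hd s hs
    rw [map_pow, map_pow]
    exact pow_mem (show _ ∈ S from ⟨t i, LaurentRing.lift_v _ _ i⟩) _
  exact h1

theorem exists_expSubst_monomial_eq_exp_of_ne_zero (hsurj : Function.Surjective e) (t : ℕ → ExpPoly e n)
    {k : ℕ} {d : Fin n ⊕ Fin k →₀ ℕ} (hd : LaurentRing.IsLowExponent k d) {c : K} (hc : c ≠ 0) :
    ∃ g : ExpPoly e n, expSubst t k (LaurentRing.ofPoly (MvPolynomial.monomial d c)) = exp g := by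
  obtain ⟨γ, hγ⟩ := hsurj (Units.mk0 c hc)
  obtain ⟨g, hg⟩ := exists_expSubst_monomial_eq_exp t hd
  refine ⟨C γ + g, ?_⟩
  have h1 : (MvPolynomial.monomial d c : MvPolynomial (Fin n ⊕ Fin k) K) =
      c • MvPolynomial.monomial d 1 := by
    rw [MvPolynomial.smul_monomial, smul_eq_mul, mul_one]
  rw [h1, map_smul, map_smul, hg, AddChar.map_add_eq_mul, Units.val_mul, exp_C, hγ,
    Units.val_mk0, ← algebraMap_eq_C, Algebra.smul_def]

end ExpSequence

end

/-! ### The Nullstellensatz -/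

theorem theorem1 {K : Type u} [Field K] [CharZero K] [IsAlgClosed K]
    (e : AddChar K Kˣ)
    (hsurj : Function.Surjective e)
    (hker : {x : K | e x = 1}.Infinite)
    (hEC : ExistentialClosedness e)
    (n : ℕ) (p : ExpPoly e n)
    (hp : ∀ g : ExpPoly e n, p ≠ (ExpPoly.exp g : ExpPoly e n)) :
    ∃ a : Fin n → K, ExpPoly.eval a p = 0 := by
  obtain ⟨κ, hκ, hκ0⟩ := hker.exists_notMem_finset {0}
  obtain ⟨t₀, ht₀⟩ := exists_isExpSequence (e := e) (n := n)
  obtain ⟨t, k, ht, _, hpt⟩ := ht₀.exists_mem p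
  obtain ⟨τ, hT⟩ := ht.exists_isExpTower
  obtain ⟨σ, hσ, hσp⟩ := exists_expSubst_eq t le_rfl hpt
  obtain ⟨f, _, d, hd, hfd⟩ := LaurentRing.exists_mul_monomial_eq hσ
  obtain ⟨g, hg⟩ := exists_expSubst_monomial_eq_exp t hd
  have hfp : expSubst t k (LaurentRing.ofPoly f) = p * ExpPoly.exp g := by
    rw [hfd, map_mul, hg, hσp]
  by_cases hf0 : f = 0
  · rw [hf0, map_zero, map_zero, eq_comm, Units.mul_left_eq_zero] at hfp
    exact ⟨0, by rw [hfp, map_zero]⟩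
  obtain ⟨a, ha⟩ := hT.exists_zero hEC hsurj hκ (by simpa using hκ0) hf0 (by
    rintro d' c hd' rfl
    have hc : c ≠ 0 := by
      rintro rfl
      exact hf0 (map_zero _)
    obtain ⟨g', hg'⟩ := exists_expSubst_monomial_eq_exp_of_ne_zero hsurj t hd' hc
    refine hp (g' - g) ?_
    rw [AddChar.map_sub_eq_div, div_eq_mul_inv, Units.val_mul, ← hg', hfp,
      Units.mul_inv_cancel_right])
  refine ⟨a, ?_⟩
  have h2 := congrArg (ExpPoly.eval a) hfp
  rw [map_mul] at h2
  have h3 : ExpPoly.eval a (expSubst t k (LaurentRing.ofPoly f)) = 0 := ha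
  rw [h3, eq_comm] at h2
  exact (mul_eq_zero.mp h2).resolve_right ((Units.isUnit _).map (ExpPoly.eval a)).ne_zero
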